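/- Work over $\mathbb{C}$, with $S=\mathbb{C}[x,y,z]$ the homogeneous coordinate ring of $\mathbb{P}^2$. For linearly independent linear forms $L_1,L_2\in S_1$ the 2-square $Z$ defined by them is the scheme with ideal $I(Z)=(L_1^2,L_2^2)$, supported at the point $P=\{L_1=L_2=0\}$. For 2-squares $Z_1,\dots,Z_s$ with pairwise distinct supports, $I(Z_1+\dots+Z_s)=\bigcap_i I(Z_i)$. Let $s\ge 0$. There is a nonempty Zariski-open subset $U$ of the space $(S_1\times S_1)^s$ of $s$-tuples of pairs of linear forms such that for every $(L_{i1},L_{i2})_{1\le i\le s}\in U$ the following holds. For each $i$ the forms $L_{i1},L_{i2}$ are linearly independent, and the 2-squares $Z_i$ with $I(Z_i)=(L_{i1}^2,L_{i2}^2)$ have pairwise distinct supports $P_i$. Moreover, for every $d\ge 0$ such that $V_d:=I(Z_1+\dots+Z_s)_d$ has positive dimension, there is a nonempty Zariski-open subset of $V_d$ all of whose elements $f$ are nonzero and satisfy, for every $i=1,\dots,s$: the curve $f=0$ has multiplicity exactly $2$ at $P_i$, and - either $P_i$ is an ordinary node of the curve (it has two distinct tangent lines there) whose tangents are symmetric with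 respect to $L_{i1},L_{i2}$, that is, they can be written as $aL_{i1}+bL_{i2}=0$ and $aL_{i1}-bL_{i2}=0$ with $a,b\in\mathbb{C}$; - or $\dim V_d=1$ and the tangent cone of the curve at $P_i$ is the double line $L_{ij}^2=0$ for some $j\in\{1,2\}$. (In the second case, which is not excluded at several or even all of the $P_i$, the curve $f=0$ is the only curve in $V_d$. In particular, if $\dim V_d\ge 2$, then every $P_i$ is an ordinary node of the generic curve of $V_d$, with tangents symmetric with respect to $L_{i1},L_{i2}$.) -/

import Mathlib

open MvPolynomial

noncomputable section

/-- The homogeneous coordinate ring `ℂ[x, y, z]` of the projective plane. -/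
abbrev PlaneRing : Type := MvPolynomial (Fin 3) ℂ

/-- The linear form with coefficient vector `c`. -/
def linForm (c : Fin 3 → ℂ) : PlaneRing := ∑ k, C (c k) * X k

/-- The ideal `(L₁², L₂²)` of the 2-square attached to a pair of linear forms (given by their
coefficient vectors); it is homogeneous and saturated when the two forms are independent. -/
def squareIdeal (L : Fin 2 → Fin 3 → ℂ) : Ideal PlaneRing :=
  Ideal.span {linForm (L 0) ^ 2, linForm (L 1) ^ 2}

/-- The ideal of the schematic union `Z₁ + ⋯ + Z_s` of the 2-squares attached to `L`. -/
def unionIdeal {s : ℕ} (L : Fin s → Fin 2 → Fin 3 → ℂ) : Ideal PlaneRing :=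
  ⨅ i, squareIdeal (L i)

/-- `V_d = I(Z₁ + ⋯ + Z_s)_d`, the space of forms of degree `d` in the ideal of the union. -/
def squareSystem {s : ℕ} (L : Fin s → Fin 2 → Fin 3 → ℂ) (d : ℕ) : Submodule ℂ PlaneRing :=
  homogeneousSubmodule (Fin 3) ℂ d ⊓ (unionIdeal L).restrictScalars ℂ

/-- `p` is a vector of homogeneous coordinates of the support of the 2-square attached to `L`:
it is nonzero and both linear forms vanish at it. -/
def IsSupportPoint (L : Fin 2 → Fin 3 → ℂ) (p : Fin 3 → ℂ) : Prop :=
  p ≠ 0 ∧ ∀ j, eval p (linForm (L j)) = 0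

/-- The pairs of linear forms really define 2-squares (the two forms of each pair are
independent), and these have pairwise disjoint supports. -/
def DefinesDisjointSquares {s : ℕ} (L : Fin s → Fin 2 → Fin 3 → ℂ) : Prop :=
  (∀ i, LinearIndependent ℂ (L i)) ∧
    ∀ i k, i ≠ k → ∀ p, ¬ (IsSupportPoint (L i) p ∧ IsSupportPoint (L k) p)

/-- `P` holds for the generic element of the finite-dimensional complex vector space `E`, that is,
on a nonempty Zariski-open subset of `E`. Polynomial functions on `E` are the polynomials in linear
functionals, and every nonempty open subset contains a nonempty one of the form `{Φ ≠ 0}`. -/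
def HoldsGenerically (E : Type*) [AddCommGroup E] [Module ℂ E] (P : E → Prop) : Prop :=
  ∃ Φ : MvPolynomial (Module.Dual ℂ E) ℂ,
    (∃ v : E, eval (fun l : Module.Dual ℂ E => l v) Φ ≠ 0) ∧
      ∀ v : E, eval (fun l : Module.Dual ℂ E => l v) Φ ≠ 0 → P v

/-- The Taylor expansion `f (p + X)` of `f` at `p`. -/
def taylorAt (p : Fin 3 → ℂ) (f : PlaneRing) : PlaneRing :=
  aeval (fun k => X k + C (p k)) f

/-- The multiplicity at the point `[p]` of the plane curve with equation `f` (a nonzero form):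
the lowest degree that occurs in the Taylor expansion of `f` at `p`. Along the line through `0`
and `p` the affine cone over the curve is locally a product, so this is also the lowest degree
in an affine chart around `[p]`. -/
def multiplicityAt (f : PlaneRing) (p : Fin 3 → ℂ) : ℕ :=
  sInf {k | homogeneousComponent k (taylorAt p f) ≠ 0}

/-- The equation of the tangent cone at `[p]` of the curve `f = 0`: the part of lowest degree of
the Taylor expansion of `f` at `p`. For a form `f` it is invariant under translation by `p`, so it
is a form in the linear forms that vanish at `p` (a product of tangent lines through `[p]`), and it
restricts to the lowest-degree part of the equation in any affine chart around `[p]`. Rescaling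
`p` only changes it by a nonzero factor. -/
def tangentCone (f : PlaneRing) (p : Fin 3 → ℂ) : PlaneRing :=
  homogeneousComponent (multiplicityAt f p) (taylorAt p f)

/-- `[p]` is an ordinary node of the curve `f = 0` whose two tangents are the lines with
coefficient vectors `M` and `M'`: a double point with two distinct tangent lines. -/
def IsOrdinaryNodeWithTangents (f : PlaneRing) (p M M' : Fin 3 → ℂ) : Prop :=
  multiplicityAt f p = 2 ∧ LinearIndependent ℂ ![M, M'] ∧
    tangentCone f p = linForm M * linForm M'

/-- `[p]` is an ordinary node of `f = 0` whose tangents are symmetric with respect to the two lines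
given by `L`: they have equations `a L₁ + b L₂ = 0` and `a L₁ - b L₂ = 0`. -/
def IsSymmetricNode (f : PlaneRing) (p : Fin 3 → ℂ) (L : Fin 2 → Fin 3 → ℂ) : Prop :=
  ∃ a b : ℂ, IsOrdinaryNodeWithTangents f p (a • L 0 + b • L 1) (a • L 0 - b • L 1)

/-- The tangent cone of `f = 0` at `[p]` is one of the double lines `L₁² = 0`, `L₂² = 0`. -/
def HasDoubleTangentAlong (f : PlaneRing) (p : Fin 3 → ℂ) (L : Fin 2 → Fin 3 → ℂ) : Prop :=
  ∃ (j : Fin 2) (c : ℂ), c ≠ 0 ∧ tangentCone f p = C c * linForm (L j) ^ 2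

end

/-! Write an element of `squareIdeal L` as A L₁² + B L₂². At a support point p its quadratic part is
A(p) L₁² + B(p) L₂². If both values are nonzero this factors as (aL₁ + bL₂)(aL₁ - bL₂), a symmetric
node; if exactly one vanishes it is a double line (`local_type`). Up to nonzero factors, B(p) and
A(p) are the second derivatives of f along the lines L₁ = 0 and L₂ = 0. So the question is when such
a derivative vanishes identically on V_d.

The main tool is deformation. The linear systems in play are kernels of matrices that depend
polynomially on the squares. Where the kernel has least dimension, every f in it extends to first
order along any path of squares, so a derivative of f along the motion agrees with some g at the
level of the tests (`exists_eq_deriv_of_finrank_ker_le`, `IsMinimal.exists_deformation`). For fat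
points this shows that a system whose multiplicity at a moving point jumps by one for free is zero
(`testSystem_fat_eq_bot`).

Suppose first that the second derivative vanishes identically along exactly one of the two lines.
Slide the square along that line, and turn the line at the speed that keeps the deformation g inside
V_d: the third derivative along the line then vanishes too (`third_deriv_eq_zero`). A member of V_d
with a triple point at P_i remains a member when the line is turned about P_i, so its third
derivatives vanish in infinitely many directions and the point is quadruple. Hence no nonzero member
has a triple point there, the remaining second derivative is injective on V_d, and dim V_d ≤ 1
(`finrank_squareTestSystem_le_one`).

Suppose next that both vanish identically at one point. By symmetry of generic squares this happens
at every point, so all members are triple at all P_i. A count excludes this when V_d ≠ 0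
(`finrank_eq_zero_of_triple`): let T be the system of forms with double points at all P_i. Strict
drops in dimension give dim T ≥ dim V_d + s, and force the mixed derivative at one point to detect
triple points within T. This propagates to all multiplicities and gives dim T ≤ d - 1. Together with
dim S_d ≤ dim T + 3s this is impossible.

Only the degrees d < 2s need generic squares. For d ≥ 2s explicit products of squares of lines show
that no second derivative vanishes identically (`exists_second_deriv_ne_zero`), so finitely many
open conditions suffice. -/

noncomputable section

/-! ### Directional derivatives and order of vanishing at a point. -/

/-- The derivative in the direction of the constant vector field `w`. -/
def dirDeriv (w : Fin 3 → ℂ) : Derivation ℂ PlaneRing PlaneRing := ∑ i, w i • pderiv i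

lemma dirDeriv_apply (w : Fin 3 → ℂ) (f : PlaneRing) :
    dirDeriv w f = ∑ i, w i • pderiv i f := by
  simp only [dirDeriv, Fin.sum_univ_three, Derivation.coe_add, Derivation.coe_smul, Pi.add_apply,
    Pi.smul_apply]

lemma eval_dirDeriv (p w : Fin 3 → ℂ) (f : PlaneRing) :
    eval p (dirDeriv w f) = ∑ i, w i * eval p (pderiv i f) := by
  simp [dirDeriv_apply, smul_eval]

lemma dirDeriv_add_vec (v w : Fin 3 → ℂ) (f : PlaneRing) :
    dirDeriv (v + w) f = dirDeriv v f + dirDeriv w f := by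
  simp [dirDeriv_apply, add_smul, Finset.sum_add_distrib]

lemma dirDeriv_smul_vec (t : ℂ) (w : Fin 3 → ℂ) (f : PlaneRing) :
    dirDeriv (t • w) f = t • dirDeriv w f := by
  simp [dirDeriv_apply, Finset.smul_sum, mul_smul]

lemma pderiv_pderiv_comm (i j : Fin 3) (f : PlaneRing) :
    pderiv i (pderiv j f) = pderiv j (pderiv i f) := by
  have h : ⁅(pderiv i : Derivation ℂ PlaneRing PlaneRing),
      (pderiv j : Derivation ℂ PlaneRing PlaneRing)⁆ = 0 := by
    apply MvPolynomial.derivation_ext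
    intro k
    rw [Derivation.commutator_apply, pderiv_X, pderiv_X]
    by_cases h1 : k = i <;> by_cases h2 : k = j <;> simp [Pi.single_apply, h1, h2] <;>
      split_ifs <;> simp
  have h' := congrArg (fun D : Derivation ℂ PlaneRing PlaneRing => D f) h
  simp only [Derivation.commutator_apply, Derivation.coe_zero, Pi.zero_apply] at h'
  exact sub_eq_zero.mp h'

lemma pderiv_dirDeriv (i : Fin 3) (w : Fin 3 → ℂ) (f : PlaneRing) :
    pderiv i (dirDeriv w f) = dirDeriv w (pderiv i f) := by
  simp only [dirDeriv_apply, map_sum, Derivation.map_smul, pderiv_pderiv_comm i]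

lemma dirDeriv_comm (v w : Fin 3 → ℂ) (f : PlaneRing) :
    dirDeriv v (dirDeriv w f) = dirDeriv w (dirDeriv v f) := by
  rw [dirDeriv_apply v, dirDeriv_apply v, map_sum]
  simp only [pderiv_dirDeriv, Derivation.map_smul]

lemma isHomogeneous_dirDeriv {f : PlaneRing} {d : ℕ} (hf : f.IsHomogeneous d)
    (w : Fin 3 → ℂ) : (dirDeriv w f).IsHomogeneous (d - 1) := by
  rw [dirDeriv_apply]
  refine IsHomogeneous.sum _ _ _ fun i _ => ?_
  rw [smul_eq_C_mul]
  exact hf.pderiv.C_mul _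

/-- Euler's identity at a point. -/
lemma eval_dirDeriv_self {f : PlaneRing} {d : ℕ} (hf : f.IsHomogeneous d) (p : Fin 3 → ℂ) :
    eval p (dirDeriv p f) = d * eval p f := by
  have h := congrArg (eval p) hf.sum_X_mul_pderiv
  simp only [map_sum, map_mul, eval_X, nsmul_eq_mul, map_natCast] at h
  rw [eval_dirDeriv, h]

/-- Iterated partial derivatives. -/
def iterPderiv : List (Fin 3) → PlaneRing →ₗ[ℂ] PlaneRing
  | [] => LinearMap.id
  | i :: l => iterPderiv l ∘ₗ (pderiv i).toLinearMap

@[simp] lemma iterPderiv_nil (f : PlaneRing) : iterPderiv [] f = f := rfl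

@[simp] lemma iterPderiv_cons (i : Fin 3) (l : List (Fin 3)) (f : PlaneRing) :
    iterPderiv (i :: l) f = iterPderiv l (pderiv i f) := rfl

lemma iterPderiv_dirDeriv (l : List (Fin 3)) (w : Fin 3 → ℂ) (f : PlaneRing) :
    iterPderiv l (dirDeriv w f) = dirDeriv w (iterPderiv l f) := by
  induction l generalizing f with
  | nil => rfl
  | cons i l ih => rw [iterPderiv_cons, iterPderiv_cons, pderiv_dirDeriv, ih]

lemma iterPderiv_pderiv (l : List (Fin 3)) (i : Fin 3) (f : PlaneRing) :
    iterPderiv l (pderiv i f) = pderiv i (iterPderiv l f) := by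
  induction l generalizing f with
  | nil => rfl
  | cons j l ih => rw [iterPderiv_cons, iterPderiv_cons, pderiv_pderiv_comm, ih]

lemma isHomogeneous_iterPderiv {f : PlaneRing} {d : ℕ} (hf : f.IsHomogeneous d)
    (l : List (Fin 3)) : (iterPderiv l f).IsHomogeneous (d - l.length) := by
  induction l generalizing f d with
  | nil => exact hf
  | cons i l ih =>
    have h := ih (hf.pderiv (i := i))
    rwa [List.length_cons, Nat.add_comm, ← Nat.sub_sub]

/-- All partial derivatives of `f` of order less than `k` vanish at `p`. -/
def VanishesToOrder (k : ℕ) (p : Fin 3 → ℂ) (f : PlaneRing) : Prop :=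
  ∀ l : List (Fin 3), l.length < k → eval p (iterPderiv l f) = 0

namespace VanishesToOrder

variable {k : ℕ} {p : Fin 3 → ℂ} {f g : PlaneRing}

lemma mono {m : ℕ} (h : VanishesToOrder k p f) (hm : m ≤ k) : VanishesToOrder m p f :=
  fun l hl => h l (hl.trans_le hm)

lemma succ_iff : VanishesToOrder (k + 1) p f ↔
    eval p f = 0 ∧ ∀ i, VanishesToOrder k p (pderiv i f) := by
  constructor
  · exact fun h => ⟨h [] (by simp), fun i l hl => h (i :: l) (by simpa using hl)⟩
  · rintro ⟨h0, h⟩ l hl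
    cases l with
    | nil => exact h0
    | cons i l => exact h i l (by simpa using hl)

lemma one_iff : VanishesToOrder 1 p f ↔ eval p f = 0 := by
  rw [succ_iff]
  exact ⟨fun h => h.1, fun h => ⟨h, fun i l hl => by simp at hl⟩⟩

lemma eval_eq_zero (h : VanishesToOrder k p f) (hk : 0 < k) : eval p f = 0 := h [] hk

lemma dirDeriv (h : VanishesToOrder k p f) (w : Fin 3 → ℂ) :
    VanishesToOrder (k - 1) p (dirDeriv w f) := by
  intro l hl
  rw [iterPderiv_dirDeriv, eval_dirDeriv]
  refine Finset.sum_eq_zero fun i _ => ?_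
  rw [← iterPderiv_pderiv, ← iterPderiv_cons, h, mul_zero]
  simp only [List.length_cons]
  omega

end VanishesToOrder

/-- By induction all first partials are zero, and Euler's identity recovers the form from them. -/
lemma eq_zero_of_vanishesToOrder {f : PlaneRing} {d : ℕ} (hf : f.IsHomogeneous d)
    {p : Fin 3 → ℂ} (h : VanishesToOrder (d + 1) p f) : f = 0 := by
  induction d generalizing f with
  | zero =>
    obtain ⟨c, rfl⟩ : ∃ c, f = C c :=
      ⟨_, totalDegree_eq_zero_iff_eq_C.mp ((totalDegree_zero_iff_isHomogeneous _).mpr hf)⟩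
    have := VanishesToOrder.one_iff.mp h
    simp only [eval_C] at this
    simp [this]
  | succ d ih =>
    have hz : ∀ i, pderiv i f = 0 := fun i =>
      ih hf.pderiv ((VanishesToOrder.succ_iff.mp h).2 i)
    have he := hf.sum_X_mul_pderiv
    simp only [hz, mul_zero, Finset.sum_const_zero] at he
    have := (smul_eq_zero.mp he.symm)
    simpa using this

/-! ### The frame given by the support point and the directions of the two lines. -/

/-- The support of the 2-square of `L`: the cross product of the two coefficient vectors. -/
def supportPt (L : Fin 2 → Fin 3 → ℂ) : Fin 3 → ℂ :=
  ![L 0 1 * L 1 2 - L 0 2 * L 1 1, L 0 2 * L 1 0 - L 0 0 * L 1 2, L 0 0 * L 1 1 - L 0 1 * L 1 0]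

/-- The direction of the line `L j = 0` in the affine chart where the last coordinate is `1`. -/
def lineDir (L : Fin 2 → Fin 3 → ℂ) (j : Fin 2) : Fin 3 → ℂ := ![L j 1, -L j 0, 0]

/-- The three directions form a basis when the support lies off the line z = 0; the proof is
Cramer's rule, with `supportPt L 2` as the determinant of the two line directions. -/
lemma eval_pderiv_eq_zero_of_frame {L : Fin 2 → Fin 3 → ℂ} (hL : supportPt L 2 ≠ 0)
    {p : Fin 3 → ℂ} {f : PlaneRing} (hp : eval p (dirDeriv (supportPt L) f) = 0)
    (hd : ∀ j, eval p (dirDeriv (lineDir L j) f) = 0) (i : Fin 3) : eval p (pderiv i f) = 0 := by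
  have h0 := hd 0
  have h1 := hd 1
  simp only [eval_dirDeriv, Fin.sum_univ_three, lineDir] at h0 h1 hp
  simp only [Matrix.cons_val_zero, Matrix.cons_val_one, Matrix.cons_val, zero_mul, add_zero]
    at h0 h1
  have e0 : eval p (pderiv 0 f) = 0 := by
    apply (mul_eq_zero.mp _).resolve_left hL
    simp only [supportPt, Matrix.cons_val]
    linear_combination L 0 0 * h1 - L 1 0 * h0
  have e1 : eval p (pderiv 1 f) = 0 := by
    apply (mul_eq_zero.mp _).resolve_left hL
    simp only [supportPt, Matrix.cons_val]
    linear_combination L 0 1 * h1 - L 1 1 * h0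
  have e2 : eval p (pderiv 2 f) = 0 := by
    rw [e0, e1] at hp
    apply (mul_eq_zero.mp _).resolve_left hL
    linear_combination hp
  fin_cases i
  exacts [e0, e1, e2]

/-- Euler's identity takes care of the radial direction, so for a form only the two line directions
have to be tested. This is what makes the plane behave like a two-dimensional chart throughout. -/
lemma vanishesToOrder_succ_of_lineDir {L : Fin 2 → Fin 3 → ℂ} (hL : supportPt L 2 ≠ 0)
    {f : PlaneRing} {d k : ℕ} (hf : f.IsHomogeneous d) (hk : 0 < k)
    (h : VanishesToOrder k (supportPt L) f)
    (hd : ∀ j, VanishesToOrder k (supportPt L) (dirDeriv (lineDir L j) f)) :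
    VanishesToOrder (k + 1) (supportPt L) f := by
  intro l hl
  cases l with
  | nil => exact h [] hk
  | cons i l =>
    have hl' : l.length < k := by simpa using hl
    rw [iterPderiv_cons, iterPderiv_pderiv]
    apply eval_pderiv_eq_zero_of_frame hL
    · rw [eval_dirDeriv_self (isHomogeneous_iterPderiv hf l), h l hl', mul_zero]
    · intro j
      rw [← iterPderiv_dirDeriv]
      exact hd j l hl'

lemma hasDerivAt_eval {γ : ℂ → Fin 3 → ℂ} {ξ : Fin 3 → ℂ} {t : ℂ} (f : PlaneRing)
    (hγ : ∀ i, HasDerivAt (fun s => γ s i) (ξ i) t) :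
    HasDerivAt (fun s => eval (γ s) f) (eval (γ t) (dirDeriv ξ f)) t := by
  induction f using MvPolynomial.induction_on with
  | C a => simpa using hasDerivAt_const t a
  | add p q hp hq => simpa only [map_add] using! hp.add hq
  | mul_X p i hp =>
    have h := hp.mul (hγ i)
    have e : dirDeriv ξ (X i : PlaneRing) = C (ξ i) := by
      rw [dirDeriv_apply, Finset.sum_eq_single i]
      · simp [smul_eq_C_mul]
      · intro j _ hj
        rw [pderiv_X_of_ne hj.symm, smul_zero]
      · simp
    simp only [Derivation.leibniz, e, map_add, map_mul, eval_X, eval_C, smul_eq_mul]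
    refine (h.congr_deriv ?_)
    ring

end

/-! ### Polynomial functions and generic properties. -/

noncomputable section

/-- The algebra of polynomial functions on a complex vector space. -/
def polyFun (E : Type*) [AddCommGroup E] [Module ℂ E] : Subalgebra ℂ (E → ℂ) :=
  (aeval (fun (l : Module.Dual ℂ E) (v : E) => l v) :
    MvPolynomial (Module.Dual ℂ E) ℂ →ₐ[ℂ] (E → ℂ)).range

section polyFun

variable {E : Type*} [AddCommGroup E] [Module ℂ E]

lemma aeval_dual_apply (Φ : MvPolynomial (Module.Dual ℂ E) ℂ) (v : E) :
    aeval (fun (l : Module.Dual ℂ E) (v : E) => l v) Φ v =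
      eval (fun l : Module.Dual ℂ E => l v) Φ := by
  induction Φ using MvPolynomial.induction_on with
  | C a => simp
  | add p q hp hq => simp [hp, hq]
  | mul_X p l hp => simp [hp]

lemma mem_polyFun_iff {F : E → ℂ} : F ∈ polyFun E ↔
    ∃ Φ : MvPolynomial (Module.Dual ℂ E) ℂ,
      ∀ v, eval (fun l : Module.Dual ℂ E => l v) Φ = F v := by
  constructor
  · intro h
    obtain ⟨Φ, h⟩ := (AlgHom.mem_range _).mp h
    exact ⟨Φ, fun v => by rw [← h, aeval_dual_apply]⟩
  · rintro ⟨Φ, h⟩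
    exact (AlgHom.mem_range _).mpr ⟨Φ, by funext v; rw [aeval_dual_apply, h]⟩

lemma dual_mem_polyFun (l : Module.Dual ℂ E) : (fun v => l v) ∈ polyFun E :=
  mem_polyFun_iff.mpr ⟨X l, fun v => by simp⟩

lemma const_mem_polyFun (c : ℂ) : (fun _ => c) ∈ polyFun E :=
  (polyFun E).algebraMap_mem c

lemma mul_mem_polyFun {F G : E → ℂ} (hF : F ∈ polyFun E) (hG : G ∈ polyFun E) :
    (fun v => F v * G v) ∈ polyFun E := (polyFun E).mul_mem hF hG

lemma add_mem_polyFun {F G : E → ℂ} (hF : F ∈ polyFun E) (hG : G ∈ polyFun E) :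
    (fun v => F v + G v) ∈ polyFun E := (polyFun E).add_mem hF hG

lemma sub_mem_polyFun {F G : E → ℂ} (hF : F ∈ polyFun E) (hG : G ∈ polyFun E) :
    (fun v => F v - G v) ∈ polyFun E := (polyFun E).sub_mem hF hG

lemma sum_mem_polyFun {ι : Type*} (s : Finset ι) {F : ι → E → ℂ}
    (hF : ∀ i ∈ s, F i ∈ polyFun E) : (fun v => ∑ i ∈ s, F i v) ∈ polyFun E := by
  have h := (polyFun E).sum_mem hF
  convert h using 1
  ext v
  simp

lemma prod_mem_polyFun {ι : Type*} (s : Finset ι) {F : ι → E → ℂ}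
    (hF : ∀ i ∈ s, F i ∈ polyFun E) : (fun v => ∏ i ∈ s, F i v) ∈ polyFun E := by
  have h := (polyFun E).prod_mem hF
  convert h using 1
  ext v
  simp

lemma det_mem_polyFun {n : Type*} [Fintype n] [DecidableEq n] {A : E → Matrix n n ℂ}
    (hA : ∀ i j, (fun v => A v i j) ∈ polyFun E) : (fun v => (A v).det) ∈ polyFun E := by
  simp only [Matrix.det_apply']
  exact sum_mem_polyFun _ fun σ _ => mul_mem_polyFun (const_mem_polyFun _)
    (prod_mem_polyFun _ fun i _ => hA _ _)

lemma eval_mem_polyFun {σ : Type*} {q : E → σ → ℂ} (hq : ∀ k, (fun v => q v k) ∈ polyFun E)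
    (f : MvPolynomial σ ℂ) : (fun v => eval (q v) f) ∈ polyFun E := by
  induction f using MvPolynomial.induction_on with
  | C a => simpa using const_mem_polyFun a
  | add p q hp hq => simpa using add_mem_polyFun hp hq
  | mul_X p k hp => simpa using mul_mem_polyFun hp (hq k)

/-- Restriction of a polynomial function to an affine line. -/
lemma exists_polynomial_on_line {F : E → ℂ} (hF : F ∈ polyFun E) (v w : E) :
    ∃ P : Polynomial ℂ, ∀ t : ℂ, P.eval t = F (v + t • w) := by
  obtain ⟨Φ, hΦ⟩ := mem_polyFun_iff.mp hF
  have h : ∀ (Ψ : MvPolynomial (Module.Dual ℂ E) ℂ) (t : ℂ),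
      (aeval (fun l : Module.Dual ℂ E =>
        Polynomial.C (l v) + Polynomial.X * Polynomial.C (l w)) Ψ).eval t =
      eval (fun l : Module.Dual ℂ E => l (v + t • w)) Ψ := by
    intro Ψ t
    induction Ψ using MvPolynomial.induction_on with
    | C a => simp
    | add p q hp hq => rw [map_add, map_add, Polynomial.eval_add, hp, hq]
    | mul_X p l hp =>
      rw [map_mul, map_mul, Polynomial.eval_mul, hp, aeval_X, eval_X, map_add, map_smul,
        smul_eq_mul, Polynomial.eval_add, Polynomial.eval_mul, Polynomial.eval_C, Polynomial.eval_X,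
        Polynomial.eval_C]
  exact ⟨_, fun t => (h Φ t).trans (hΦ _)⟩

end polyFun

/-- `P` holds on a Zariski neighbourhood of `v`. -/
def HoldsNear {E : Type*} [AddCommGroup E] [Module ℂ E] (v : E) (P : E → Prop) : Prop :=
  ∃ F ∈ polyFun E, F v ≠ 0 ∧ ∀ w, F w ≠ 0 → P w

section Generic

variable {E : Type*} [AddCommGroup E] [Module ℂ E] {P Q : E → Prop}

lemma holdsGenerically_iff : HoldsGenerically E P ↔ ∃ v, HoldsNear v P := by
  constructor
  · rintro ⟨Φ, ⟨v, hv⟩, h⟩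
    exact ⟨v, _, mem_polyFun_iff.mpr ⟨Φ, fun _ => rfl⟩, hv, h⟩
  · rintro ⟨v, F, hF, hv, h⟩
    obtain ⟨Φ, hΦ⟩ := mem_polyFun_iff.mp hF
    exact ⟨Φ, ⟨v, by rwa [hΦ]⟩, fun w hw => h w (by rwa [← hΦ])⟩

lemma HoldsGenerically.mono (h : HoldsGenerically E P) (hPQ : ∀ v, P v → Q v) :
    HoldsGenerically E Q := by
  obtain ⟨Φ, hv, h⟩ := h
  exact ⟨Φ, hv, fun v hv => hPQ v (h v hv)⟩

lemma HoldsGenerically.of_forall (h : ∀ v, P v) : HoldsGenerically E P :=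
  ⟨1, ⟨0, by simp⟩, fun v _ => h v⟩

lemma holdsGenerically_of_ne_zero {F : E → ℂ} (hF : F ∈ polyFun E) (h : ∃ v, F v ≠ 0) :
    HoldsGenerically E fun v => F v ≠ 0 := by
  obtain ⟨v, hv⟩ := h
  exact holdsGenerically_iff.mpr ⟨v, F, hF, hv, fun _ h => h⟩

/-- Irreducibility of affine space: on the line joining the two good points both functions restrict
to nonzero polynomials in one variable, and their product is nonzero at some point. -/
lemma HoldsGenerically.and (hP : HoldsGenerically E P) (hQ : HoldsGenerically E Q) :
    HoldsGenerically E fun v => P v ∧ Q v := by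
  obtain ⟨v, F, hF, hv, h1⟩ := holdsGenerically_iff.mp hP
  obtain ⟨w, G, hG, hw, h2⟩ := holdsGenerically_iff.mp hQ
  obtain ⟨p, hp⟩ := exists_polynomial_on_line hF v (w - v)
  obtain ⟨q, hq⟩ := exists_polynomial_on_line hG v (w - v)
  have hp0 : p ≠ 0 := by
    rintro rfl
    have := hp 0
    simp at this
    exact hv this.symm
  have hq0 : q ≠ 0 := by
    rintro rfl
    have := hq 1
    simp at this
    exact hw this.symm
  obtain ⟨t, ht⟩ := Polynomial.exists_eval_ne_zero_of_natDegree_lt_card (p * q)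
    (mul_ne_zero hp0 hq0) (by simpa using (Cardinal.natCast_lt_aleph0 (n := (p * q).natDegree)).trans_le (Cardinal.aleph0_le_mk ℂ))
  rw [Polynomial.eval_mul, hp, hq] at ht
  refine holdsGenerically_iff.mpr ⟨v + t • (w - v), _, mul_mem_polyFun hF hG, ht, fun x hx => ?_⟩
  exact ⟨h1 x (left_ne_zero_of_mul hx), h2 x (right_ne_zero_of_mul hx)⟩

lemma holdsGenerically_forall_mem {ι : Type*} {s : Set ι} (hs : s.Finite) {P : ι → E → Prop}
    (h : ∀ i ∈ s, HoldsGenerically E (P i)) : HoldsGenerically E fun v => ∀ i ∈ s, P i v := by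
  induction s, hs using Set.Finite.induction_on with
  | empty => exact .of_forall (by simp)
  | @insert a s _ _ ih =>
    refine ((h a (Set.mem_insert _ _)).and
      (ih fun i hi => h i (Set.mem_insert_of_mem _ hi))).mono fun v hv i hi => ?_
    rcases hi with rfl | hi
    exacts [hv.1, hv.2 i hi]

lemma holdsGenerically_forall {ι : Type*} [Finite ι] {P : ι → E → Prop}
    (h : ∀ i, HoldsGenerically E (P i)) : HoldsGenerically E fun v => ∀ i, P i v :=
  (holdsGenerically_forall_mem Set.finite_univ (fun i _ => h i)).mono fun _ hv i => hv i trivial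

open Topology in
lemma HoldsNear.eventually_line {v : E} (h : HoldsNear v P) (w : E) :
    ∀ᶠ t : ℂ in 𝓝 0, P (v + t • w) := by
  obtain ⟨F, hF, hv, h⟩ := h
  obtain ⟨p, hp⟩ := exists_polynomial_on_line hF v w
  have hc : ∀ᶠ t : ℂ in 𝓝 0, p.eval t ≠ 0 :=
    p.continuous.continuousAt.eventually_ne (by rw [hp]; simpa using hv)
  filter_upwards [hc] with t ht
  exact h _ (by rwa [← hp])

end Generic

/-! ### Semicontinuity of the rank and first-order deformation of kernels. -/

section Rank

variable {S W : Type*} [AddCommGroup S] [Module ℂ S] [FiniteDimensional ℂ S]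
  {κ : Type*} [Fintype κ]

lemma finrank_ker_le_of_injective_comp {r : ℕ} [AddCommGroup W] [Module ℂ W] (M : S →ₗ[ℂ] W) {e : Fin r → S}
    (he : LinearIndependent ℂ fun j => M (e j)) :
    Module.finrank ℂ (LinearMap.ker M) + r ≤ Module.finrank ℂ S := by
  have h1 := M.finrank_range_add_finrank_ker
  have h2 : r ≤ Module.finrank ℂ (LinearMap.range M) := by
    have h3 : LinearIndependent ℂ fun j => (⟨M (e j), ⟨_, rfl⟩⟩ : LinearMap.range M) :=
      LinearIndependent.of_comp (LinearMap.range M).subtype he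
    simpa using h3.fintype_card_le_finrank
  omega

lemma exists_linearIndependent_image [AddCommGroup W] [Module ℂ W] (M : S →ₗ[ℂ] W) :
    ∃ (r : ℕ) (e : Fin r → S), Module.finrank ℂ (LinearMap.ker M) + r = Module.finrank ℂ S ∧
      LinearIndependent ℂ (fun j => M (e j)) ∧
      Submodule.span ℂ (Set.range fun j => M (e j)) = LinearMap.range M := by
  have b := Module.finBasis ℂ (LinearMap.range M)
  choose e he using fun j => (b j).2
  refine ⟨_, e, (add_comm _ _).trans M.finrank_range_add_finrank_ker, ?_, ?_⟩
  · simp only [he]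
    have h := b.linearIndependent.map' (LinearMap.range M).subtype (Submodule.ker_subtype _)
    simpa only [Function.comp_def, Submodule.subtype_apply] using h
  · simp only [he]
    have := b.span_eq
    have h2 := congrArg (Submodule.map (LinearMap.range M).subtype) this
    rw [Submodule.map_span, ← Set.range_comp, Submodule.map_subtype_top] at h2
    exact h2

/-- The kernel of a linear map that depends polynomially on parameters has, near a given parameter,
at most the dimension that it has there. -/
lemma holdsNear_finrank_ker_le {E : Type*} [AddCommGroup E] [Module ℂ E]
    (M : E → S →ₗ[ℂ] (κ → ℂ)) (hM : ∀ f k, (fun v => M v f k) ∈ polyFun E) (v : E) :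
    HoldsNear v fun w => Module.finrank ℂ (LinearMap.ker (M w)) ≤
      Module.finrank ℂ (LinearMap.ker (M v)) := by
  classical
  obtain ⟨r, e, hr, he, -⟩ := exists_linearIndependent_image (M v)
  -- A left inverse G of the inclusion of the span of the `M v (e j)` yields an r × r determinant
  -- that depends polynomially on the parameter, equals 1 at v, and where nonzero keeps the images
  -- of the `e j` independent.
  obtain ⟨G, hG⟩ := LinearMap.exists_leftInverse_of_injective
    (Fintype.linearCombination ℂ fun j => M v (e j))
    (LinearMap.ker_eq_bot.mpr he.fintypeLinearCombination_injective)
  let A : E → Matrix (Fin r) (Fin r) ℂ := fun w => .of fun i j => G (M w (e j)) i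
  refine ⟨fun w => (A w).det, det_mem_polyFun fun i j => ?_, ?_, fun w hw => ?_⟩
  · have h : ∀ w, A w i j = ∑ k, M w (e j) k * G (Pi.single k 1) i := by
      intro w
      have : M w (e j) = ∑ k, M w (e j) k • Pi.single k (1 : ℂ) := by
        ext k; simp [Finset.sum_apply, Pi.single_apply]
      simp only [A, Matrix.of_apply]
      conv_lhs => rw [this]
      simp
    simp only [h]
    exact sum_mem_polyFun _ fun k _ => mul_mem_polyFun (hM _ _) (const_mem_polyFun _)
  · have h : A v = 1 := by
      ext i j
      have := congrFun (LinearMap.congr_fun hG (Pi.single j 1)) i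
      simp [Fintype.linearCombination_apply_single] at this
      simp [A, this, Matrix.one_apply, Pi.single_apply]
    simp [h]
  · have hli : LinearIndependent ℂ fun j => M w (e j) := by
      have h1 : LinearIndependent ℂ (A w).col :=
        Matrix.linearIndependent_cols_of_det_ne_zero hw
      exact LinearIndependent.of_comp G h1
    have := finrank_ker_le_of_injective_comp (M w) hli
    omega

open Topology in
/-- If the kernel of `M t` has minimal dimension at `t = 0`, then the derivative at `0` maps
`ker (M 0)` to the range of `M 0`. -/
lemma exists_eq_deriv_of_finrank_ker_le [NormedAddCommGroup W] [NormedSpace ℂ W]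
    (M : ℂ → S →ₗ[ℂ] W) {f : S} {D : S → W}
    (hD : ∀ g, HasDerivAt (fun t => M t g) (D g) 0)
    (hmin : ∀ t, Module.finrank ℂ (LinearMap.ker (M 0)) ≤ Module.finrank ℂ (LinearMap.ker (M t)))
    (hf : M 0 f = 0) : ∃ g, M 0 g = D f := by
  by_contra hno
  obtain ⟨r, e, hr, he, hspan⟩ := exists_linearIndependent_image (M 0)
  have hli : LinearIndependent ℂ (Fin.cons (D f) fun j => M 0 (e j) : Fin (r + 1) → W) := by
    rw [linearIndependent_finCons, hspan]
    exact ⟨he, fun ⟨g, hg⟩ => hno ⟨g, hg⟩⟩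
  -- Since `M 0 f = 0`, the vectors `t⁻¹ • M t f` tend to `D f`. If `D f` were outside the range,
  -- openness of linear independence would make the rank of `M t` larger than that of `M 0` for some
  -- small t ≠ 0.
  have htend : Filter.Tendsto
      (fun t : ℂ => (Fin.cons (t⁻¹ • M t f) fun j => M t (e j) : Fin (r + 1) → W))
      (𝓝[≠] 0) (𝓝 (Fin.cons (D f) fun j => M 0 (e j))) := by
    rw [tendsto_pi_nhds]
    intro i
    refine Fin.cases ?_ (fun j => ?_) i
    · have := (hD f).tendsto_slope_zero
      simpa [hf] using this
    · exact (hD (e j)).continuousAt.tendsto.mono_left nhdsWithin_le_nhds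
  have hev := htend.eventually (isOpen_setOfPred_linearIndependent.mem_nhds hli)
  obtain ⟨t, ht, ht0⟩ := (hev.and self_mem_nhdsWithin).exists
  have h2 : LinearIndependent ℂ fun i => M t ((Fin.cons (t⁻¹ • f) e : Fin (r + 1) → S) i) := by
    have h3 : (fun i => M t ((Fin.cons (t⁻¹ • f) e : Fin (r + 1) → S) i)) =
        Fin.cons (t⁻¹ • M t f) fun j => M t (e j) := by
      funext i
      refine Fin.cases ?_ (fun j => ?_) i <;> simp
    rw [h3]
    exact ht
  have := finrank_ker_le_of_injective_comp (M t) h2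
  have := hmin t
  omega

/-- The form in which linear conditions are counted below: each functional lowers the dimension by
at most one. -/
lemma finrank_le_add_card_of_forall {V : Type*} [AddCommGroup V] [Module ℂ V]
    {A B : Submodule ℂ V} [FiniteDimensional ℂ B] {ι : Type*} [Fintype ι] (φ : ι → V →ₗ[ℂ] ℂ)
    (h : ∀ f ∈ B, (∀ i, φ i f = 0) → f ∈ A) [FiniteDimensional ℂ A] :
    Module.finrank ℂ B ≤ Module.finrank ℂ A + Fintype.card ι := by
  have h1 := (LinearMap.pi φ ∘ₗ B.subtype).finrank_range_add_finrank_ker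
  have h2 := (LinearMap.range (LinearMap.pi φ ∘ₗ B.subtype)).finrank_le
  rw [Module.finrank_fintype_fun_eq_card] at h2
  have h3 : Module.finrank ℂ (LinearMap.ker (LinearMap.pi φ ∘ₗ B.subtype)) ≤
      Module.finrank ℂ A := by
    refine LinearMap.finrank_le_finrank_of_injective
      (f := ((B.subtype ∘ₗ (LinearMap.ker (LinearMap.pi φ ∘ₗ B.subtype)).subtype).codRestrict A
        fun f => h _ f.1.2 fun i => ?_)) ?_
    · exact congrFun f.2 i
    · intro f g hfg
      exact Subtype.ext (Subtype.ext (congrArg (fun x : A => (x : V)) hfg))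
  omega

end Rank
end

/-! ### Linear systems cut out by tests at the supports, and parameters of minimal dimension. -/

noncomputable section

/-- Linear tests for the local behaviour of a form at the support of a 2-square: iterated partial
derivatives, and second derivatives along the two lines of the square. -/
abbrev LocalTest : Type := List (Fin 3) ⊕ (Fin 2 × Fin 2)

/-- The value of a test at the support of the 2-square of `L`. -/
def testAt (L : Fin 2 → Fin 3 → ℂ) : LocalTest → PlaneRing →ₗ[ℂ] ℂ
  | .inl l => (aeval (supportPt L)).toLinearMap ∘ₗ iterPderiv l
  | .inr (j, k) => (aeval (supportPt L)).toLinearMap ∘ₗ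
      (dirDeriv (lineDir L j)).toLinearMap ∘ₗ (dirDeriv (lineDir L k)).toLinearMap

lemma testAt_inl (L : Fin 2 → Fin 3 → ℂ) (l : List (Fin 3)) (f : PlaneRing) :
    testAt L (.inl l) f = eval (supportPt L) (iterPderiv l f) := rfl

lemma testAt_inr (L : Fin 2 → Fin 3 → ℂ) (j k : Fin 2) (f : PlaneRing) :
    testAt L (.inr (j, k)) f =
      eval (supportPt L) (dirDeriv (lineDir L j) (dirDeriv (lineDir L k) f)) := rfl

/-- The tests for multiplicity at least `k`. -/
def fatTests (k : ℕ) : Set LocalTest := {x | ∃ l : List (Fin 3), l.length < k ∧ x = .inl l}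

/-- The tests for membership in the ideal of a 2-square. -/
def squareTests : Set LocalTest := insert (.inr (0, 1)) (fatTests 2)

/-- The tests for membership in the ideal of a 2-square with vanishing second derivative along
the line `L j = 0`. -/
def tangentTests (j : Fin 2) : Set LocalTest := insert (.inr (j, j)) squareTests

lemma finite_fatTests (k : ℕ) : (fatTests k).Finite := by
  have h : fatTests k = Sum.inl '' {l : List (Fin 3) | l.length < k} := by
    ext x
    simp only [fatTests, Set.mem_ofPred_eq, Set.mem_image]
    exact ⟨fun ⟨l, h1, h2⟩ => ⟨l, h1, h2.symm⟩, fun ⟨l, h1, h2⟩ => ⟨l, h1, h2.symm⟩⟩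
  rw [h]
  exact (List.finite_length_lt _ _).image _

lemma finite_squareTests : squareTests.Finite := (finite_fatTests 2).insert _

lemma finite_tangentTests (j : Fin 2) : (tangentTests j).Finite := finite_squareTests.insert _

lemma forall_fatTests {L : Fin 2 → Fin 3 → ℂ} {k : ℕ} {f : PlaneRing} :
    (∀ x ∈ fatTests k, testAt L x f = 0) ↔ VanishesToOrder k (supportPt L) f := by
  constructor
  · exact fun h l hl => h _ ⟨l, hl, rfl⟩
  · rintro h _ ⟨l, hl, rfl⟩
    exact h l hl

lemma forall_squareTests {L : Fin 2 → Fin 3 → ℂ} {f : PlaneRing} :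
    (∀ x ∈ squareTests, testAt L x f = 0) ↔ testAt L (.inr (0, 1)) f = 0 ∧
      VanishesToOrder 2 (supportPt L) f := by
  rw [squareTests, Set.forall_mem_insert, forall_fatTests]

lemma forall_tangentTests {L : Fin 2 → Fin 3 → ℂ} {j : Fin 2} {f : PlaneRing} :
    (∀ x ∈ tangentTests j, testAt L x f = 0) ↔ testAt L (.inr (j, j)) f = 0 ∧
      ∀ x ∈ squareTests, testAt L x f = 0 := by
  rw [tangentTests, Set.forall_mem_insert]

variable {s : ℕ}

/-- The forms of degree `d` that pass the tests `c i` at the support of `L i`, for all `i`. -/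
def testSystem (d : ℕ) (c : Fin s → Set LocalTest) (L : Fin s → Fin 2 → Fin 3 → ℂ) :
    Submodule ℂ PlaneRing :=
  homogeneousSubmodule (Fin 3) ℂ d ⊓ ⨅ i, ⨅ x ∈ c i, LinearMap.ker (testAt (L i) x)

lemma mem_testSystem {d : ℕ} {c : Fin s → Set LocalTest} {L : Fin s → Fin 2 → Fin 3 → ℂ}
    {f : PlaneRing} : f ∈ testSystem d c L ↔
      f.IsHomogeneous d ∧ ∀ i, ∀ x ∈ c i, testAt (L i) x f = 0 := by
  simp [testSystem, Submodule.mem_iInf, mem_homogeneousSubmodule]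

instance finiteDimensional_homogeneousSubmodule (d : ℕ) :
    FiniteDimensional ℂ (homogeneousSubmodule (Fin 3) ℂ d) :=
  Module.Finite.iff_fg.mpr (homogeneousSubmodule_fg _ _ d)

instance finiteDimensional_testSystem (d : ℕ) (c : Fin s → Set LocalTest)
    (L : Fin s → Fin 2 → Fin 3 → ℂ) : FiniteDimensional ℂ (testSystem d c L) :=
  Submodule.finiteDimensional_of_le inf_le_left

/-- At `L` the space `testSystem d c L` has the smallest dimension that occurs. -/
def IsMinimal (d : ℕ) (c : Fin s → Set LocalTest) (L : Fin s → Fin 2 → Fin 3 → ℂ) : Prop :=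
  ∀ L', Module.finrank ℂ (testSystem d c L) ≤ Module.finrank ℂ (testSystem d c L')

/-- All tests together, as a linear map on the space of forms of degree `d`. -/
def testMap (d : ℕ) (c : Fin s → Set LocalTest) (L : Fin s → Fin 2 → Fin 3 → ℂ) :
    homogeneousSubmodule (Fin 3) ℂ d →ₗ[ℂ] ((Σ i, c i) → ℂ) :=
  LinearMap.pi fun x => testAt (L x.1) x.2.1 ∘ₗ Submodule.subtype _

lemma testMap_apply (d : ℕ) (c : Fin s → Set LocalTest) (L : Fin s → Fin 2 → Fin 3 → ℂ)
    (f : homogeneousSubmodule (Fin 3) ℂ d) (x : Σ i, c i) :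
    testMap d c L f x = testAt (L x.1) x.2.1 f := rfl

lemma mem_ker_testMap {d : ℕ} {c : Fin s → Set LocalTest} {L : Fin s → Fin 2 → Fin 3 → ℂ}
    {f : homogeneousSubmodule (Fin 3) ℂ d} :
    f ∈ LinearMap.ker (testMap d c L) ↔ (f : PlaneRing) ∈ testSystem d c L := by
  rw [LinearMap.mem_ker, mem_testSystem]
  constructor
  · exact fun h => ⟨f.2, fun i x hx => congrFun h ⟨i, x, hx⟩⟩
  · exact fun h => funext fun x => h.2 x.1 x.2.1 x.2.2

lemma finrank_ker_testMap (d : ℕ) (c : Fin s → Set LocalTest) (L : Fin s → Fin 2 → Fin 3 → ℂ) :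
    Module.finrank ℂ (LinearMap.ker (testMap d c L)) = Module.finrank ℂ (testSystem d c L) := by
  have h : testSystem d c L = (LinearMap.ker (testMap d c L)).map (Submodule.subtype _) := by
    ext f
    simp only [Submodule.mem_map, mem_ker_testMap, Submodule.subtype_apply]
    constructor
    · exact fun hf => ⟨⟨f, (mem_testSystem.mp hf).1⟩, hf, rfl⟩
    · rintro ⟨g, hg, rfl⟩
      exact hg
  rw [h, Submodule.finrank_map_subtype_eq]

lemma coord_mem_polyFun (i : Fin s) (j : Fin 2) (k : Fin 3) :
    (fun L : Fin s → Fin 2 → Fin 3 → ℂ => L i j k) ∈ polyFun (Fin s → Fin 2 → Fin 3 → ℂ) :=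
  dual_mem_polyFun ((LinearMap.proj k : (Fin 3 → ℂ) →ₗ[ℂ] ℂ) ∘ₗ
    (LinearMap.proj j : (Fin 2 → Fin 3 → ℂ) →ₗ[ℂ] _) ∘ₗ
    (LinearMap.proj i : (Fin s → Fin 2 → Fin 3 → ℂ) →ₗ[ℂ] _))

lemma supportPt_mem_polyFun (i : Fin s) (k : Fin 3) :
    (fun L : Fin s → Fin 2 → Fin 3 → ℂ => supportPt (L i) k) ∈
      polyFun (Fin s → Fin 2 → Fin 3 → ℂ) := by
  have h := fun j k => coord_mem_polyFun i j k
  fin_cases k <;> simp only [supportPt] <;>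
    exact sub_mem_polyFun (mul_mem_polyFun (h _ _) (h _ _)) (mul_mem_polyFun (h _ _) (h _ _))

lemma lineDir_mem_polyFun (i : Fin s) (j : Fin 2) (k : Fin 3) :
    (fun L : Fin s → Fin 2 → Fin 3 → ℂ => lineDir (L i) j k) ∈
      polyFun (Fin s → Fin 2 → Fin 3 → ℂ) := by
  fin_cases k
  · exact coord_mem_polyFun i j 1
  · exact (polyFun _).neg_mem (coord_mem_polyFun i j 0)
  · exact const_mem_polyFun 0

lemma testAt_mem_polyFun (i : Fin s) (x : LocalTest) (f : PlaneRing) :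
    (fun L : Fin s → Fin 2 → Fin 3 → ℂ => testAt (L i) x f) ∈
      polyFun (Fin s → Fin 2 → Fin 3 → ℂ) := by
  rcases x with l | ⟨j, k⟩
  · exact eval_mem_polyFun (supportPt_mem_polyFun i) _
  · simp only [testAt_inr, eval_dirDeriv]
    refine sum_mem_polyFun _ fun a _ => mul_mem_polyFun (lineDir_mem_polyFun i j a) ?_
    simp only [pderiv_dirDeriv, eval_dirDeriv]
    exact sum_mem_polyFun _ fun b _ => mul_mem_polyFun (lineDir_mem_polyFun i k b)
      (eval_mem_polyFun (supportPt_mem_polyFun i) _)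

lemma IsMinimal.holdsNear {d : ℕ} {c : Fin s → Set LocalTest} (hc : ∀ i, (c i).Finite)
    {L : Fin s → Fin 2 → Fin 3 → ℂ} (hL : IsMinimal d c L) : HoldsNear L (IsMinimal d c) := by
  have := fun i => (hc i).fintype
  obtain ⟨F, hF, h0, h⟩ := holdsNear_finrank_ker_le (testMap d c)
    (fun f x => testAt_mem_polyFun x.1 x.2.1 f) L
  refine ⟨F, hF, h0, fun L' hL' L'' => ?_⟩
  have h1 := h L' hL'
  rw [finrank_ker_testMap, finrank_ker_testMap] at h1
  exact h1.trans (hL L'')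

lemma holdsGenerically_isMinimal {d : ℕ} {c : Fin s → Set LocalTest} (hc : ∀ i, (c i).Finite) :
    HoldsGenerically (Fin s → Fin 2 → Fin 3 → ℂ) (IsMinimal d c) := by
  have hmin : IsMinimal d c (Function.argmin fun L => Module.finrank ℂ (testSystem d c L)) :=
    fun L' => Function.argmin_le (fun L => Module.finrank ℂ (testSystem d c L)) L'
  exact holdsGenerically_iff.mpr ⟨_, hmin.holdsNear hc⟩

/-- Infinitesimal deformation of a form along with the `i`-th square. -/
lemma IsMinimal.exists_deformation {d : ℕ} {c : Fin s → Set LocalTest} (hc : ∀ i, (c i).Finite)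
    {L : Fin s → Fin 2 → Fin 3 → ℂ} (hL : IsMinimal d c L) (i : Fin s)
    {ℓ : ℂ → Fin 2 → Fin 3 → ℂ} (hℓ : ℓ 0 = L i) {D : LocalTest → PlaneRing → ℂ}
    (hD : ∀ x f, HasDerivAt (fun t => testAt (ℓ t) x f) (D x f) 0)
    {f : PlaneRing} (hf : f ∈ testSystem d c L) :
    ∃ g : PlaneRing, g.IsHomogeneous d ∧ (∀ k, k ≠ i → ∀ x ∈ c k, testAt (L k) x g = 0) ∧
      ∀ x ∈ c i, testAt (L i) x g = - D x f := by
  classical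
  have := fun i => (hc i).fintype
  have h0 : Function.update L i (ℓ 0) = L := by rw [hℓ, Function.update_eq_self]
  have hf0 : testMap d c (Function.update L i (ℓ 0)) ⟨f, (mem_testSystem.mp hf).1⟩ = 0 := by
    rw [h0]
    exact LinearMap.mem_ker.mp (mem_ker_testMap.mpr hf)
  have hmin : ∀ t, Module.finrank ℂ (LinearMap.ker (testMap d c (Function.update L i (ℓ 0)))) ≤
      Module.finrank ℂ (LinearMap.ker (testMap d c (Function.update L i (ℓ t)))) := by
    intro t
    rw [finrank_ker_testMap, finrank_ker_testMap, h0]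
    exact hL _
  have hder : ∀ h : homogeneousSubmodule (Fin 3) ℂ d,
      HasDerivAt (fun t => testMap d c (Function.update L i (ℓ t)) h)
        (fun x => if x.1 = i then D x.2.1 h else 0) 0 := by
    intro h
    rw [hasDerivAt_pi]
    rintro ⟨k, x⟩
    by_cases hk : k = i
    · subst hk
      simpa [testMap_apply] using hD x h
    · simpa [testMap_apply, hk] using hasDerivAt_const (0 : ℂ) (testAt (L k) x.1 h)
  obtain ⟨g, hg⟩ := exists_eq_deriv_of_finrank_ker_le
    (S := homogeneousSubmodule (Fin 3) ℂ d) (W := (Σ i, c i) → ℂ)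
    (M := fun t => testMap d c (Function.update L i (ℓ t))) hder hmin hf0
  rw [h0] at hg
  -- The sign: if f extends to a family f_t in the moving kernels, differentiating M_t f_t = 0 gives
  -- M_0 f' = -M' f. The form -g plays the role of f'.
  refine ⟨-g, (mem_homogeneousSubmodule _ _).mp (Submodule.neg_mem _ g.2), fun k hk x hx => ?_,
    fun x hx => ?_⟩
  · have h := congrFun hg ⟨k, x, hx⟩
    rw [testMap_apply] at h
    simp only [hk, if_false] at h
    rw [map_neg, h, neg_zero]
  · have h := congrFun hg ⟨i, x, hx⟩
    rw [testMap_apply] at h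
    simp only [if_true] at h
    rw [map_neg, h]

/-! ### Sliding and turning a 2-square. -/

/-- The path of 2-squares that moves the support along the line `L j = 0` and turns this line
with speed `μ`. -/
def slidePath (L : Fin 2 → Fin 3 → ℂ) (j : Fin 2) (μ t : ℂ) : Fin 2 → Fin 3 → ℂ :=
  fun k => L k + t • (if k = j then μ • L (1 - j) else ![0, 0, 1])

/-- The sign with which `slidePath` moves the support. -/
def slideSign (j : Fin 2) : ℂ := if j = 0 then 1 else -1

lemma slideSign_ne_zero (j : Fin 2) : slideSign j ≠ 0 := by
  unfold slideSign; split_ifs <;> simp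

/-- Adding a multiple of z to the other line translates that line in the affine chart, so the common
point travels along the line L j = 0; the turning speed μ enters only at second order in t. -/
lemma supportPt_slidePath (L : Fin 2 → Fin 3 → ℂ) (j : Fin 2) (μ t : ℂ) :
    supportPt (slidePath L j μ t) = supportPt L +
      (slideSign j * t) • (lineDir L j + (t * μ) • lineDir L (1 - j)) := by
  funext i
  fin_cases j <;> fin_cases i <;>
    simp [supportPt, slidePath, lineDir, slideSign] <;> ring

lemma lineDir_slidePath (L : Fin 2 → Fin 3 → ℂ) (j : Fin 2) (μ t : ℂ) (k : Fin 2) :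
    lineDir (slidePath L j μ t) k = lineDir L k +
      t • (if k = j then μ • lineDir L (1 - j) else 0) := by
  funext i
  fin_cases j <;> fin_cases k <;> fin_cases i <;>
    simp [slidePath, lineDir] <;> ring

/-- The derivatives of the tests along `slidePath`. -/
def slideDeriv (L : Fin 2 → Fin 3 → ℂ) (j : Fin 2) (μ : ℂ) : LocalTest → PlaneRing → ℂ
  | .inl l, f => slideSign j * eval (supportPt L) (dirDeriv (lineDir L j) (iterPderiv l f))
  | .inr (k, m), f =>
    slideSign j * eval (supportPt L) (dirDeriv (lineDir L j)
      (dirDeriv (lineDir L k) (dirDeriv (lineDir L m) f))) +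
    (if k = j then μ * eval (supportPt L)
      (dirDeriv (lineDir L (1 - j)) (dirDeriv (lineDir L m) f)) else 0) +
    (if m = j then μ * eval (supportPt L)
      (dirDeriv (lineDir L k) (dirDeriv (lineDir L (1 - j)) f)) else 0)

lemma hasDerivAt_eval_supportPt_slidePath (L : Fin 2 → Fin 3 → ℂ) (j : Fin 2) (μ : ℂ)
    (f : PlaneRing) : HasDerivAt (fun t => eval (supportPt (slidePath L j μ t)) f)
      (slideSign j * eval (supportPt L) (dirDeriv (lineDir L j) f)) 0 := by
  have h := hasDerivAt_eval (γ := fun t => supportPt (slidePath L j μ t))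
    (ξ := slideSign j • lineDir L j) (t := 0) f fun i => by
      simp only [supportPt_slidePath, Pi.add_apply, Pi.smul_apply, smul_eq_mul]
      have h1 := ((hasDerivAt_id (0 : ℂ)).const_mul (slideSign j)).mul
        ((((hasDerivAt_id (0 : ℂ)).mul_const μ).mul_const (lineDir L (1 - j) i)).const_add
          (lineDir L j i))
      refine (h1.const_add (supportPt L i)).congr_deriv ?_
      simp
  refine h.congr_deriv ?_
  simp [supportPt_slidePath, dirDeriv_smul_vec, smul_eval]

lemma hasDerivAt_testAt_slidePath (L : Fin 2 → Fin 3 → ℂ) (j : Fin 2) (μ : ℂ) (x : LocalTest)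
    (f : PlaneRing) :
    HasDerivAt (fun t => testAt (slidePath L j μ t) x f) (slideDeriv L j μ x f) 0 := by
  rcases x with l | ⟨k, m⟩
  · exact hasDerivAt_eval_supportPt_slidePath L j μ _
  · have H := fun g => hasDerivAt_eval_supportPt_slidePath L j μ g
    have e0 : supportPt (slidePath L j μ 0) = supportPt L := by simp [supportPt_slidePath]
    set w : Fin 2 → Fin 3 → ℂ := fun k => if k = j then μ • lineDir L (1 - j) else 0 with hw
    have hfun : (fun t => testAt (slidePath L j μ t) (.inr (k, m)) f) = fun t =>
        (eval (supportPt (slidePath L j μ t))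
          (dirDeriv (lineDir L k) (dirDeriv (lineDir L m) f)) +
        t * eval (supportPt (slidePath L j μ t)) (dirDeriv (w k) (dirDeriv (lineDir L m) f))) +
        (t * eval (supportPt (slidePath L j μ t)) (dirDeriv (lineDir L k) (dirDeriv (w m) f)) +
        t * (t * eval (supportPt (slidePath L j μ t)) (dirDeriv (w k) (dirDeriv (w m) f)))) := by
      funext t
      simp only [testAt_inr, lineDir_slidePath, dirDeriv_add_vec, dirDeriv_smul_vec, map_add,
        Derivation.map_smul, smul_eval, hw]
      ring
    rw [hfun]
    have hid := hasDerivAt_id (0 : ℂ)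
    refine (((H _).add (hid.mul (H _))).add ((hid.mul (H _)).add
      (hid.mul (hid.mul (H _))))).congr_deriv ?_
    simp only [slideDeriv, e0, id, hw]
    split_ifs <;> simp [dirDeriv_smul_vec, smul_eval, dirDeriv_apply 0]

end

/-! ### Fat points at moving supports, and identical vanishing along exactly one line. -/

noncomputable section

lemma VanishesToOrder.add {k : ℕ} {p : Fin 3 → ℂ} {f g : PlaneRing}
    (hf : VanishesToOrder k p f) (hg : VanishesToOrder k p g) : VanishesToOrder k p (f + g) := by
  intro l hl
  rw [map_add, map_add, hf l hl, hg l hl, add_zero]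

/-- The second derivatives along the two lines detect vanishing to third order. -/
lemma vanishesToOrder_three {L : Fin 2 → Fin 3 → ℂ} (hL : supportPt L 2 ≠ 0) {f : PlaneRing}
    {d : ℕ} (hf : f.IsHomogeneous d) (h2 : VanishesToOrder 2 (supportPt L) f)
    (h : ∀ j k, testAt L (.inr (j, k)) f = 0) : VanishesToOrder 3 (supportPt L) f :=
  vanishesToOrder_succ_of_lineDir hL hf two_pos h2 fun k =>
    vanishesToOrder_succ_of_lineDir hL (isHomogeneous_dirDeriv hf _) one_pos
      (h2.dirDeriv _) fun j => VanishesToOrder.one_iff.mpr (h j k)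

lemma vanishesToOrder_four {L : Fin 2 → Fin 3 → ℂ} (hL : supportPt L 2 ≠ 0) {f : PlaneRing}
    {d : ℕ} (hf : f.IsHomogeneous d) (h3 : VanishesToOrder 3 (supportPt L) f)
    (h : ∀ i j k, eval (supportPt L) (dirDeriv (lineDir L i) (dirDeriv (lineDir L j)
      (dirDeriv (lineDir L k) f))) = 0) : VanishesToOrder 4 (supportPt L) f :=
  vanishesToOrder_succ_of_lineDir hL hf three_pos h3 fun k =>
    vanishesToOrder_three hL (isHomogeneous_dirDeriv hf _) (h3.dirDeriv _) fun i j => h i j k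

lemma testAt_inr_eq_zero {L : Fin 2 → Fin 3 → ℂ} {f : PlaneRing}
    (h : VanishesToOrder 3 (supportPt L) f) (j k : Fin 2) : testAt L (.inr (j, k)) f = 0 := by
  rw [testAt_inr]
  exact ((h.dirDeriv (lineDir L k)).dirDeriv (lineDir L j)).eval_eq_zero (by norm_num)

lemma eq_or_eq_one_sub (j k : Fin 2) : k = j ∨ k = 1 - j := by
  revert j k
  decide

lemma testAt_inr_comm (L : Fin 2 → Fin 3 → ℂ) (f : PlaneRing) (j k : Fin 2) :
    testAt L (.inr (j, k)) f = testAt L (.inr (k, j)) f := by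
  rw [testAt_inr, testAt_inr, dirDeriv_comm]

lemma forall_testAt_inr {L : Fin 2 → Fin 3 → ℂ} {f : PlaneRing}
    (h : testAt L (.inr (0, 1)) f = 0) (h' : ∀ j, testAt L (.inr (j, j)) f = 0) (j k : Fin 2) :
    testAt L (.inr (j, k)) f = 0 := by
  fin_cases j <;> fin_cases k
  exacts [h' 0, h, (testAt_inr_comm L f 1 0).trans h, h' 1]

variable {s : ℕ} {d : ℕ} {L : Fin s → Fin 2 → Fin 3 → ℂ}

lemma mem_testSystem_update {c : Fin s → Set LocalTest} {i : Fin s} {T : Set LocalTest}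
    {f : PlaneRing} : f ∈ testSystem d (Function.update c i T) L ↔
      f.IsHomogeneous d ∧ (∀ k, k ≠ i → ∀ x ∈ c k, testAt (L k) x f = 0) ∧
        ∀ x ∈ T, testAt (L i) x f = 0 := by
  rw [mem_testSystem]
  refine and_congr_right fun _ => ⟨fun h => ⟨fun k hk => ?_, ?_⟩, fun h k => ?_⟩
  · simpa [hk] using h k
  · simpa using h i
  · by_cases hk : k = i
    · subst hk; simpa using h.2
    · simpa [hk] using h.1 k hk

lemma mem_testSystem_update_fat {c : Fin s → Set LocalTest} {i : Fin s} {n : ℕ}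
    {f : PlaneRing} : f ∈ testSystem d (Function.update c i (fatTests n)) L ↔
      f.IsHomogeneous d ∧ (∀ k, k ≠ i → ∀ x ∈ c k, testAt (L k) x f = 0) ∧
        VanishesToOrder n (supportPt (L i)) f := by
  rw [mem_testSystem_update, forall_fatTests]

lemma finite_update {c : Fin s → Set LocalTest} (hc : ∀ k, (c k).Finite) (i : Fin s)
    {T : Set LocalTest} (hT : T.Finite) (k : Fin s) : (Function.update c i T k).Finite := by
  by_cases hk : k = i
  · subst hk; simpa using hT
  · simpa [hk] using hc k

/-- The infinitesimal deformation of a form with a fat point. -/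
lemma exists_deformation_fat {c : Fin s → Set LocalTest} (hc : ∀ k, (c k).Finite) {i : Fin s}
    {n : ℕ} (hmin : IsMinimal d (Function.update c i (fatTests n)) L) {f : PlaneRing}
    (hf : f ∈ testSystem d (Function.update c i (fatTests n)) L) (j : Fin 2) :
    ∃ g ∈ testSystem d (Function.update c i (fatTests (n - 1))) L,
      VanishesToOrder n (supportPt (L i))
        (g + slideSign j • dirDeriv (lineDir (L i) j) f) := by
  obtain ⟨g, hg, hne, hi⟩ := hmin.exists_deformation (finite_update hc i (finite_fatTests n)) i
    (ℓ := slidePath (L i) j 0) (by funext k; simp [slidePath])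
    (hasDerivAt_testAt_slidePath (L i) j 0) hf
  have hi' : VanishesToOrder n (supportPt (L i))
      (g + slideSign j • dirDeriv (lineDir (L i) j) f) := by
    intro l hl
    have h := hi (.inl l) (by rw [Function.update_self]; exact ⟨l, hl, rfl⟩)
    rw [testAt_inl] at h
    rw [map_add, map_add, h, map_smul, smul_eval, iterPderiv_dirDeriv]
    simp [slideDeriv]
  -- Differentiating costs one order of vanishing, so g itself is only known to have multiplicity n
  -- - 1.
  have hD := (mem_testSystem_update_fat.mp hf).2.2.dirDeriv (lineDir (L i) j)
  refine ⟨g, mem_testSystem_update_fat.mpr ⟨hg, fun k hk x hx => hne k hk x (by simpa [hk] using hx),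
    fun l hl => ?_⟩, hi'⟩
  have h := hi' l (by omega)
  rw [map_add, map_add, map_smul, smul_eval, hD l hl, mul_zero, add_zero] at h
  exact h

lemma VanishesToOrder.of_add_smul {k : ℕ} {p : Fin 3 → ℂ} {f g : PlaneRing} {ε : ℂ} (hε : ε ≠ 0)
    (h : VanishesToOrder k p (g + ε • f)) (hg : VanishesToOrder k p g) :
    VanishesToOrder k p f := by
  intro l hl
  have := h l hl
  rw [map_add, map_add, hg l hl, map_smul, smul_eval, zero_add] at this
  exact (mul_eq_zero.mp this).resolve_left hε

/-- If raising the multiplicity at a moving point does not change a linear system,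
then the system is zero. -/
lemma testSystem_fat_eq_bot {c : Fin s → Set LocalTest} (hc : ∀ k, (c k).Finite) {i : Fin s}
    (hL : supportPt (L i) 2 ≠ 0) {k : ℕ} (hk : 0 < k)
    (hmin : ∀ n ≤ d, IsMinimal d (Function.update c i (fatTests n)) L)
    (h : testSystem d (Function.update c i (fatTests k)) L ≤
      testSystem d (Function.update c i (fatTests (k + 1))) L) :
    testSystem d (Function.update c i (fatTests k)) L = ⊥ := by
  have key : ∀ n, k + n ≤ d → testSystem d (Function.update c i (fatTests k)) L ≤
      testSystem d (Function.update c i (fatTests (k + n + 1))) L := by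
    intro n
    induction n with
    | zero => exact fun _ => h
    | succ n ih =>
      intro hn f hf
      have ih' := ih (by omega)
      have hf' := ih' hf
      rw [mem_testSystem_update_fat] at hf' ⊢
      refine ⟨hf'.1, hf'.2.1, ?_⟩
      refine vanishesToOrder_succ_of_lineDir hL hf'.1 (by omega) hf'.2.2 fun j => ?_
      -- The form g has multiplicity at least k + n ≥ k, hence lies in the original system and, by
      -- the inductive hypothesis, vanishes to order k + n + 1. Therefore so does the derivative of
      -- f.
      obtain ⟨g, hg, hgf⟩ := exists_deformation_fat hc (hmin (k + n + 1) (by omega)) (ih' hf) j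
      have hg' : g ∈ testSystem d (Function.update c i (fatTests k)) L := by
        rw [mem_testSystem_update_fat] at hg ⊢
        exact ⟨hg.1, hg.2.1, hg.2.2.mono (by omega)⟩
      exact hgf.of_add_smul (slideSign_ne_zero j) (mem_testSystem_update_fat.mp (ih' hg')).2.2
  rw [eq_bot_iff]
  intro f hf
  rw [Submodule.mem_bot]
  have hf0 := mem_testSystem_update_fat.mp hf
  by_cases hkd : k ≤ d
  · have hf' := mem_testSystem_update_fat.mp (key (d - k) (by omega) hf)
    rw [Nat.add_sub_cancel' hkd] at hf'
    exact eq_zero_of_vanishesToOrder hf0.1 hf'.2.2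
  · exact eq_zero_of_vanishesToOrder hf0.1 (hf0.2.2.mono (by omega))

/-- The linear system of the 2-squares, given by tests. -/
abbrev squareTestSystem (d : ℕ) (L : Fin s → Fin 2 → Fin 3 → ℂ) : Submodule ℂ PlaneRing :=
  testSystem d (fun _ => squareTests) L

lemma mem_testSystem_update_tangent {i : Fin s} {j : Fin 2} {f : PlaneRing} :
    f ∈ testSystem d (Function.update (fun _ => squareTests) i (tangentTests j)) L ↔
      f ∈ squareTestSystem d L ∧ testAt (L i) (.inr (j, j)) f = 0 := by
  rw [mem_testSystem_update, forall_tangentTests, mem_testSystem]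
  constructor
  · rintro ⟨h1, h2, h3, h4⟩
    refine ⟨⟨h1, fun k => ?_⟩, h3⟩
    by_cases hk : k = i
    · subst hk; exact h4
    · exact h2 k hk
  · rintro ⟨⟨h1, h2⟩, h3⟩
    exact ⟨h1, fun k _ => h2 k, h3, h2 i⟩

/-- The third derivative along a line vanishes if the second one does so identically on a
deformation, provided that the second derivative along the other line does not vanish. -/
lemma third_deriv_eq_zero_of_ne {i : Fin s} {j : Fin 2} (hL : supportPt (L i) 2 ≠ 0)
    (hmin : IsMinimal d (Function.update (fun _ => squareTests) i (tangentTests j)) L)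
    (hj : ∀ f ∈ squareTestSystem d L, testAt (L i) (.inr (j, j)) f = 0) {f : PlaneRing}
    (hf : f ∈ squareTestSystem d L) (hf' : testAt (L i) (.inr (1 - j, 1 - j)) f ≠ 0) :
    eval (supportPt (L i)) (dirDeriv (lineDir (L i) j) (dirDeriv (lineDir (L i) j)
      (dirDeriv (lineDir (L i) j) f))) = 0 := by
  set p := supportPt (L i) with hp
  set b := lineDir (L i) with hb
  -- The speed is the solution of the linear equation saying that the mixed second derivative of the
  -- deformation g vanishes, which puts g back into the system of the 2-squares.
  set μ : ℂ := -(slideSign j * eval p (dirDeriv (b (1 - j)) (dirDeriv (b j) (dirDeriv (b j) f)))) /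
    testAt (L i) (.inr (1 - j, 1 - j)) f with hμ
  obtain ⟨g, hg, hne, hi⟩ := hmin.exists_deformation
    (finite_update (fun _ => finite_squareTests) i (finite_tangentTests j)) i
    (ℓ := slidePath (L i) j μ) (by funext k; simp [slidePath])
    (hasDerivAt_testAt_slidePath (L i) j μ) (mem_testSystem_update_tangent.mpr ⟨hf, hj f hf⟩)
  simp only [Function.update_self] at hi
  have hhom := (mem_testSystem.mp hf).1
  obtain ⟨h01, h2⟩ := forall_squareTests.mp ((mem_testSystem.mp hf).2 i)
  have hmix : testAt (L i) (.inr (1 - j, j)) f = 0 := by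
    fin_cases j
    · exact (testAt_inr_comm _ _ _ _).trans h01
    · exact h01
  -- Both second derivatives of f involving direction j vanish at p. Hence the slide along that line
  -- imposes no first-order change on the multiplicity-2 tests, and g is again double.
  have hDj : VanishesToOrder 2 p (dirDeriv (b j) f) := by
    refine vanishesToOrder_succ_of_lineDir hL (isHomogeneous_dirDeriv hhom _) one_pos
      (h2.dirDeriv _) fun k => VanishesToOrder.one_iff.mpr ?_
    have hjj := hj f hf
    fin_cases j <;> fin_cases k
    exacts [hjj, hmix, hmix, hjj]
  have hg2 : VanishesToOrder 2 p g := by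
    intro l hl
    have h := hi (.inl l) (Set.mem_insert_of_mem _ (Set.mem_insert_of_mem _ ⟨l, hl, rfl⟩))
    rw [testAt_inl] at h
    rw [h]
    simp only [slideDeriv]
    rw [← iterPderiv_dirDeriv, hDj l hl, mul_zero, neg_zero]
  have hg01 : testAt (L i) (.inr (0, 1)) g = 0 := by
    rw [hi _ (Set.mem_insert_of_mem _ (Set.mem_insert _ _)), neg_eq_zero]
    have hkey : slideSign j * eval p (dirDeriv (b (1 - j)) (dirDeriv (b j) (dirDeriv (b j) f))) +
        μ * testAt (L i) (.inr (1 - j, 1 - j)) f = 0 := by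
      rw [hμ, div_mul_cancel₀ _ hf', add_neg_cancel]
    rw [← hkey]
    fin_cases j
    · simp only [slideDeriv, testAt_inr, ← hb, ← hp, Fin.zero_eta, Fin.isValue, sub_zero,
        if_true, one_ne_zero, if_false, add_zero]
      rw [dirDeriv_comm (b 0) (b 1) f, dirDeriv_comm (b 0) (b 1)]
    · simp only [slideDeriv, testAt_inr, ← hb, ← hp, Fin.mk_one, Fin.isValue, sub_self,
        if_true, zero_ne_one, if_false, add_zero]
      rw [dirDeriv_comm (b 1) (b 0)]
  have hgV : g ∈ squareTestSystem d L := by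
    refine mem_testSystem.mpr ⟨hg, fun k => ?_⟩
    by_cases hk : k = i
    · subst hk; exact forall_squareTests.mpr ⟨hg01, hg2⟩
    · exact fun x hx => hne k hk x (by simpa [hk] using hx)
  -- As g lies in the system, its second derivative along line j vanishes by hypothesis. The turning
  -- terms are mixed derivatives of f, which vanish, so only the third derivative of f remains.
  have h := hi (.inr (j, j)) (Set.mem_insert _ _)
  rw [hj g hgV] at h
  have e1 : eval (supportPt (L i)) (dirDeriv (lineDir (L i) (1 - j))
      (dirDeriv (lineDir (L i) j) f)) = 0 := hmix
  have e2 : eval (supportPt (L i)) (dirDeriv (lineDir (L i) j)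
      (dirDeriv (lineDir (L i) (1 - j)) f)) = 0 := by rw [dirDeriv_comm, e1]
  simp only [slideDeriv, if_true, e1, e2, mul_zero, add_zero] at h
  rw [eq_comm, neg_eq_zero] at h
  exact (mul_eq_zero.mp h).resolve_left (slideSign_ne_zero j)

/-- Linearity removes the nonvanishing condition: a form violating it satisfies it after adding a
form that does not. -/
lemma third_deriv_eq_zero {i : Fin s} {j : Fin 2} (hL : supportPt (L i) 2 ≠ 0)
    (hmin : IsMinimal d (Function.update (fun _ => squareTests) i (tangentTests j)) L)
    (hj : ∀ f ∈ squareTestSystem d L, testAt (L i) (.inr (j, j)) f = 0)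
    (hj' : ∃ f ∈ squareTestSystem d L, testAt (L i) (.inr (1 - j, 1 - j)) f ≠ 0) {f : PlaneRing}
    (hf : f ∈ squareTestSystem d L) :
    eval (supportPt (L i)) (dirDeriv (lineDir (L i) j) (dirDeriv (lineDir (L i) j)
      (dirDeriv (lineDir (L i) j) f))) = 0 := by
  by_cases h : testAt (L i) (.inr (1 - j, 1 - j)) f = 0
  · obtain ⟨g, hg, hg'⟩ := hj'
    have h1 := third_deriv_eq_zero_of_ne hL hmin hj hg hg'
    have h2 := third_deriv_eq_zero_of_ne hL hmin hj (add_mem hf hg)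
      (by rwa [map_add, h, zero_add])
    simpa only [map_add, h1, add_zero] using h2
  · exact third_deriv_eq_zero_of_ne hL hmin hj hf h

lemma IsMinimal.finrank_eq {c : Fin s → Set LocalTest} {L' : Fin s → Fin 2 → Fin 3 → ℂ}
    (h : IsMinimal d c L) (h' : IsMinimal d c L') :
    Module.finrank ℂ (testSystem d c L) = Module.finrank ℂ (testSystem d c L') :=
  le_antisymm (h L') (h' L)

/-- Stating the vanishing as an equality of dimensions lets it be transported between parameters,
and between points, at which these dimensions are minimal. -/
lemma forall_testAt_eq_zero_iff_finrank {i : Fin s} {j : Fin 2} :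
    (∀ f ∈ squareTestSystem d L, testAt (L i) (.inr (j, j)) f = 0) ↔
      Module.finrank ℂ (testSystem d (Function.update (fun _ => squareTests) i (tangentTests j)) L)
        = Module.finrank ℂ (squareTestSystem d L) := by
  have hle : testSystem d (Function.update (fun _ => squareTests) i (tangentTests j)) L ≤
      squareTestSystem d L := fun f hf => (mem_testSystem_update_tangent.mp hf).1
  constructor
  · intro h
    rw [le_antisymm hle fun f hf => mem_testSystem_update_tangent.mpr ⟨hf, h f hf⟩]
  · intro h f hf
    rw [← Submodule.eq_of_le_of_finrank_eq hle h] at hf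
    exact (mem_testSystem_update_tangent.mp hf).2

/-- Identical vanishing of a second derivative is the same at all minimal parameters. -/
lemma forall_testAt_eq_zero_congr {i : Fin s} {j : Fin 2} {L' : Fin s → Fin 2 → Fin 3 → ℂ}
    (h : IsMinimal d (fun _ => squareTests) L) (h' : IsMinimal d (fun _ => squareTests) L')
    (ht : IsMinimal d (Function.update (fun _ => squareTests) i (tangentTests j)) L)
    (ht' : IsMinimal d (Function.update (fun _ => squareTests) i (tangentTests j)) L') :
    (∀ f ∈ squareTestSystem d L, testAt (L i) (.inr (j, j)) f = 0) ↔
      ∀ f ∈ squareTestSystem d L', testAt (L' i) (.inr (j, j)) f = 0 := by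
  rw [forall_testAt_eq_zero_iff_finrank, forall_testAt_eq_zero_iff_finrank, h.finrank_eq h',
    ht.finrank_eq ht']

open Topology in
lemma cubic_coeff_eq_zero {a b c e : ℂ}
    (h : ∀ᶠ t : ℂ in 𝓝 0, a + b * t + c * t ^ 2 + e * t ^ 3 = 0) :
    a = 0 ∧ b = 0 ∧ c = 0 ∧ e = 0 := by
  set P : Polynomial ℂ := .C a + .C b * .X + .C c * .X ^ 2 + .C e * .X ^ 3 with hP
  have h0 : P = 0 := by
    refine Polynomial.eq_zero_of_infinite_isRoot P (infinite_of_mem_nhds 0 ?_)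
    filter_upwards [h] with t ht
    simpa [Polynomial.IsRoot, hP] using ht
  have hc : ∀ n, P.coeff n = 0 := fun n => by rw [h0, Polynomial.coeff_zero]
  have h1 := hc 0
  have h2 := hc 1
  have h3 := hc 2
  have h4 := hc 3
  simp [hP, Polynomial.coeff_X, Polynomial.coeff_C, Polynomial.coeff_X_pow] at h1 h2 h3 h4
  exact ⟨h1, h2, h3, h4⟩

/-- The variation of a pair of lines that turns the `j`-th line around the common point. -/
def turnVec (L : Fin 2 → Fin 3 → ℂ) (j : Fin 2) : Fin 2 → Fin 3 → ℂ := Pi.single j (L (1 - j))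

lemma supportPt_turn (L : Fin 2 → Fin 3 → ℂ) (j : Fin 2) (t : ℂ) :
    supportPt (L + t • turnVec L j) = supportPt L := by
  funext i
  fin_cases j <;> fin_cases i <;> simp [supportPt, turnVec] <;> ring

lemma lineDir_turn (L : Fin 2 → Fin 3 → ℂ) (j : Fin 2) (t : ℂ) :
    lineDir (L + t • turnVec L j) j = lineDir L j + t • lineDir L (1 - j) := by
  funext i
  fin_cases j <;> fin_cases i <;> simp [lineDir, turnVec] <;> ring

/-- If the second derivative along exactly one line of a 2-square vanishes identically on the
linear system, then the system has dimension at most one. -/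
lemma finrank_squareTestSystem_le_one {i : Fin s} {j : Fin 2} (hL : supportPt (L i) 2 ≠ 0)
    (hsq : IsMinimal d (fun _ => squareTests) L)
    (htan : ∀ k, IsMinimal d (Function.update (fun _ => squareTests) i (tangentTests k)) L)
    (hfat : ∀ n ≤ d, IsMinimal d (Function.update (fun _ => squareTests) i (fatTests n)) L)
    (hj : ∀ f ∈ squareTestSystem d L, testAt (L i) (.inr (j, j)) f = 0)
    (hj' : ∃ f ∈ squareTestSystem d L, testAt (L i) (.inr (1 - j, 1 - j)) f ≠ 0) :
    Module.finrank ℂ (squareTestSystem d L) ≤ 1 := by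
  -- No nonzero member has a triple point at this support: triple is shown to imply quadruple.
  have hW : testSystem d (Function.update (fun _ => squareTests) i (fatTests 3)) L = ⊥ := by
    refine testSystem_fat_eq_bot (fun _ => finite_squareTests) hL three_pos hfat fun f hf => ?_
    rw [mem_testSystem_update_fat] at hf ⊢
    obtain ⟨hhom, hne, h3⟩ := hf
    refine ⟨hhom, hne, ?_⟩
    set b := lineDir (L i) with hb
    set p := supportPt (L i) with hp
    -- A triple point satisfies the tests of a 2-square for every choice of lines through it. So f
    -- stays in the system when line j is turned about p, and the vanishing of the third derivative
    -- applies to the turned line for all small t.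
    have hev : ∀ᶠ t : ℂ in nhds 0,
        eval p (dirDeriv (b j + t • b (1 - j)) (dirDeriv (b j + t • b (1 - j))
          (dirDeriv (b j + t • b (1 - j)) f))) = 0 := by
      set w : Fin s → Fin 2 → Fin 3 → ℂ := Pi.single i (turnVec (L i) j) with hw
      filter_upwards [(hsq.holdsNear fun _ => finite_squareTests).eventually_line w,
        ((htan 0).holdsNear (finite_update (fun _ => finite_squareTests) i
          (finite_tangentTests 0))).eventually_line w,
        ((htan 1).holdsNear (finite_update (fun _ => finite_squareTests) i
          (finite_tangentTests 1))).eventually_line w] with t ht ht0 ht1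
      have htan' : ∀ k, IsMinimal d
          (Function.update (fun _ => squareTests) i (tangentTests k)) (L + t • w) := by
        intro k; fin_cases k
        exacts [ht0, ht1]
      have hi : (L + t • w) i = L i + t • turnVec (L i) j := by simp [hw]
      have hk : ∀ k, k ≠ i → (L + t • w) k = L k := fun k hk => by simp [hw, hk]
      have h := third_deriv_eq_zero (L := L + t • w) (i := i) (j := j) (d := d) (f := f)
        (by rw [hi, supportPt_turn]; exact hL) (htan' j)
        ((forall_testAt_eq_zero_congr hsq ht (htan j) (htan' j)).mp hj) (by
          by_contra hcon
          push Not at hcon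
          obtain ⟨f, hf, hf'⟩ := hj'
          exact hf' ((forall_testAt_eq_zero_congr hsq ht (htan _) (htan' _)).mpr hcon f hf))
        (by
          refine mem_testSystem.mpr ⟨hhom, fun k => ?_⟩
          by_cases hki : k = i
          · subst hki
            have h3' : VanishesToOrder 3 (supportPt ((L + t • w) k)) f := by
              rwa [hi, supportPt_turn]
            exact forall_squareTests.mpr ⟨testAt_inr_eq_zero h3' _ _, h3'.mono (by omega)⟩
          · rw [hk k hki]
            exact hne k hki)
      rwa [hi, supportPt_turn, lineDir_turn] at h
    -- The expression is the cubic part of f restricted to a direction varying with t; its four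
    -- coefficients are, up to binomial factors, all third derivatives in the two line directions.
    have hcoef := cubic_coeff_eq_zero
      (a := eval p (dirDeriv (b j) (dirDeriv (b j) (dirDeriv (b j) f))))
      (b := 3 * eval p (dirDeriv (b j) (dirDeriv (b j) (dirDeriv (b (1 - j)) f))))
      (c := 3 * eval p (dirDeriv (b j) (dirDeriv (b (1 - j)) (dirDeriv (b (1 - j)) f))))
      (e := eval p (dirDeriv (b (1 - j)) (dirDeriv (b (1 - j)) (dirDeriv (b (1 - j)) f)))) (by
        filter_upwards [hev] with t ht
        rw [← ht]
        simp only [dirDeriv_add_vec, dirDeriv_smul_vec, map_add, Derivation.map_smul, smul_eval]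
        simp only [dirDeriv_comm (b (1 - j)) (b j)]
        ring)
    obtain ⟨h0, h1, h2, h4⟩ := hcoef
    have h1' := (mul_eq_zero.mp h1).resolve_left three_ne_zero
    have h2' := (mul_eq_zero.mp h2).resolve_left three_ne_zero
    refine vanishesToOrder_four hL hhom h3 fun k m n => ?_
    have cm := dirDeriv_comm (b (1 - j)) (b j)
    change eval p (dirDeriv (b k) (dirDeriv (b m) (dirDeriv (b n) f))) = 0
    rcases eq_or_eq_one_sub j k with hk | hk <;> rcases eq_or_eq_one_sub j m with hm | hm <;>
      rcases eq_or_eq_one_sub j n with hn | hn <;> rw [hk, hm, hn] <;>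
      simp only [cm, h0, h1', h2', h4]
  -- If the remaining second derivative also vanishes, the point is triple. So that single
  -- functional is injective on the system.
  have hker : ∀ f ∈ squareTestSystem d L, testAt (L i) (.inr (1 - j, 1 - j)) f = 0 →
      f ∈ (⊥ : Submodule ℂ PlaneRing) := by
    intro f hf h0
    have hf' := mem_testSystem.mp hf
    obtain ⟨h01, h2⟩ := forall_squareTests.mp (hf'.2 i)
    have h3 : VanishesToOrder 3 (supportPt (L i)) f := by
      refine vanishesToOrder_three hL hf'.1 h2 (forall_testAt_inr h01 fun k => ?_)
      rcases eq_or_eq_one_sub j k with hk | hk <;> rw [hk]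
      exacts [hj f hf, h0]
    rw [← hW]
    exact mem_testSystem_update_fat.mpr ⟨hf'.1, fun k _ => hf'.2 k, h3⟩
  have h := finrank_le_add_card_of_forall (A := ⊥) (B := squareTestSystem d L)
    (fun _ : Unit => testAt (L i) (.inr (1 - j, 1 - j))) fun f hf h0 => hker f hf (h0 ())
  rwa [finrank_bot, zero_add, Fintype.card_unit] at h

end

/-! ### Identical vanishing along both lines: the dimension count. -/

noncomputable section

/-- The independent monomials are x^j y^(i-j) z^(d-i) with j ≤ i ≤ d. Only this lower bound enters
the count. -/
lemma le_finrank_homogeneousSubmodule (d : ℕ) :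
    (d + 1) * (d + 2) ≤ 2 * Module.finrank ℂ (homogeneousSubmodule (Fin 3) ℂ d) := by
  let e : (Σ i : Fin (d + 1), Fin (i + 1)) → (Fin 3 →₀ ℕ) := fun x =>
    Finsupp.equivFunOnFinite.symm ![x.2, x.1 - x.2, d - x.1]
  have he : Function.Injective e := by
    rintro ⟨i, j⟩ ⟨i', j'⟩ h
    have h' := Finsupp.equivFunOnFinite.symm.injective h
    have h0 := congrFun h' 0
    have h1 := congrFun h' 1
    simp at h0 h1
    have hi : i = i' := Fin.ext (by omega)
    subst hi
    have hj : j = j' := Fin.ext h0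
    rw [hj]
  have hdeg : ∀ x, (monomial (e x) (1 : ℂ)) ∈ homogeneousSubmodule (Fin 3) ℂ d := by
    rintro ⟨i, j⟩
    rw [mem_homogeneousSubmodule]
    refine isHomogeneous_monomial _ ?_
    simp [e, Finsupp.degree_eq_sum, Fin.sum_univ_three]
    omega
  have hli : LinearIndependent ℂ fun x => (⟨_, hdeg x⟩ : homogeneousSubmodule (Fin 3) ℂ d) := by
    refine LinearIndependent.of_comp (Submodule.subtype _) ?_
    have := (basisMonomials (Fin 3) ℂ).linearIndependent.comp e he
    simpa [Function.comp_def] using this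
  have h := hli.fintype_card_le_finrank
  have hsum : Fintype.card (Σ i : Fin (d + 1), Fin (i + 1)) * 2 = (d + 2) * (d + 1) := by
    rw [Fintype.card_sigma]
    simp only [Fintype.card_fin]
    rw [Fin.sum_univ_eq_sum_range (fun i => i + 1), show (d + 2) * (d + 1) = (d + 2) * (d + 2 - 1) from rfl,
      ← Finset.sum_range_id_mul_two (d + 2), Finset.sum_range_succ' _ (d + 1), add_zero]
  nlinarith

lemma VanishesToOrder.pow_dirDeriv {k : ℕ} {p : Fin 3 → ℂ} {f : PlaneRing}
    (h : VanishesToOrder k p f) (w : Fin 3 → ℂ) (n : ℕ) :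
    VanishesToOrder (k - n) p (((_root_.dirDeriv w).toLinearMap ^ n) f) := by
  induction n with
  | zero => simpa using h
  | succ n ih =>
    rw [pow_succ', Module.End.mul_apply, ← Nat.sub_sub]
    exact ih.dirDeriv w

/-- The derivative of type `D₀ D₁ⁿ` at the support of the 2-square. -/
def mixedDeriv (L : Fin 2 → Fin 3 → ℂ) (n : ℕ) : PlaneRing →ₗ[ℂ] ℂ :=
  (aeval (supportPt L)).toLinearMap ∘ₗ (dirDeriv (lineDir L 0)).toLinearMap ∘ₗ
    (dirDeriv (lineDir L 1)).toLinearMap ^ n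

lemma mixedDeriv_eq_zero {L : Fin 2 → Fin 3 → ℂ} {n : ℕ} {f : PlaneRing}
    (h : VanishesToOrder (n + 2) (supportPt L) f) : mixedDeriv L n f = 0 :=
  ((h.pow_dirDeriv (lineDir L 1) n).dirDeriv (lineDir L 0)).eval_eq_zero (by omega)

/-- Moving one D₁ next to f turns the expression into a derivative of order n + 2 of D₁ f. This is
why the direction D₁ is treated before D₀ in the induction on the multiplicity. -/
lemma mixedDeriv_dirDeriv_zero {L : Fin 2 → Fin 3 → ℂ} {n : ℕ} {f : PlaneRing}
    (h : VanishesToOrder (n + 3) (supportPt L) (dirDeriv (lineDir L 1) f)) :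
    mixedDeriv L (n + 1) (dirDeriv (lineDir L 0) f) = 0 := by
  have h1 : mixedDeriv L (n + 1) (dirDeriv (lineDir L 0) f) =
      mixedDeriv L n (dirDeriv (lineDir L 0) (dirDeriv (lineDir L 1) f)) := by
    rw [dirDeriv_comm]
    simp only [mixedDeriv, pow_succ]
    rfl
  rw [h1]
  exact mixedDeriv_eq_zero (h.dirDeriv _)

lemma mixedDeriv_dirDeriv_one (L : Fin 2 → Fin 3 → ℂ) (n : ℕ) (f : PlaneRing) :
    mixedDeriv L n (dirDeriv (lineDir L 1) f) = mixedDeriv L (n + 1) f := by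
  simp only [mixedDeriv, pow_succ]
  rfl

variable {s : ℕ} {d : ℕ} {L : Fin s → Fin 2 → Fin 3 → ℂ}

/-- If at a fat point of multiplicity 2 of a linear system the mixed second derivative
detects multiplicity 3, then similarly for all higher multiplicities. -/
lemma mem_fat_succ_of_mixedDeriv {c : Fin s → Set LocalTest} (hc : ∀ k, (c k).Finite) {i : Fin s}
    (hL : supportPt (L i) 2 ≠ 0)
    (hmin : ∀ n ≤ d, IsMinimal d (Function.update c i (fatTests n)) L)
    (h2 : ∀ f ∈ testSystem d (Function.update c i (fatTests 2)) L, mixedDeriv (L i) 1 f = 0 →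
      f ∈ testSystem d (Function.update c i (fatTests 3)) L) (n : ℕ) (hn : n + 2 ≤ d) :
    ∀ f ∈ testSystem d (Function.update c i (fatTests (n + 2))) L,
      mixedDeriv (L i) (n + 1) f = 0 →
      f ∈ testSystem d (Function.update c i (fatTests (n + 3))) L := by
  induction n with
  | zero => exact h2
  | succ n ih =>
    intro f hf hfm
    have key : ∀ j, mixedDeriv (L i) (n + 1) (dirDeriv (lineDir (L i) j) f) = 0 →
        VanishesToOrder (n + 3) (supportPt (L i)) (dirDeriv (lineDir (L i) j) f) := by
      intro j hj
      -- The mixed derivative of order n + 2 kills g plus a multiple of the derivative of f, and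
      -- kills that derivative by hypothesis. So it kills g, and the inductive hypothesis raises the
      -- multiplicity of g.
      obtain ⟨g, hg, hgf⟩ := exists_deformation_fat hc (hmin (n + 3) (by omega)) hf j
      have hg0 := mixedDeriv_eq_zero (n := n + 1) hgf
      rw [map_add, map_smul, hj, smul_zero, add_zero] at hg0
      exact hgf.of_add_smul (slideSign_ne_zero j)
        (mem_testSystem_update_fat.mp (ih (by omega) g hg hg0)).2.2
    have h1 := key 1 (by rw [mixedDeriv_dirDeriv_one]; exact hfm)
    have h0 := key 0 (mixedDeriv_dirDeriv_zero h1)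
    have hf' := mem_testSystem_update_fat.mp hf
    refine mem_testSystem_update_fat.mpr ⟨hf'.1, hf'.2.1,
      vanishesToOrder_succ_of_lineDir hL hf'.1 (by omega) hf'.2.2 fun j => ?_⟩
    fin_cases j
    exacts [h0, h1]

/-- Each step from multiplicity 2 up to d + 1 costs at most one condition, the mixed derivative, and
at multiplicity d + 1 nothing is left. -/
lemma finrank_fat_two_le {c : Fin s → Set LocalTest} (hc : ∀ k, (c k).Finite) {i : Fin s}
    (hL : supportPt (L i) 2 ≠ 0)
    (hmin : ∀ n ≤ d, IsMinimal d (Function.update c i (fatTests n)) L)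
    (h2 : ∀ f ∈ testSystem d (Function.update c i (fatTests 2)) L, mixedDeriv (L i) 1 f = 0 →
      f ∈ testSystem d (Function.update c i (fatTests 3)) L) :
    Module.finrank ℂ (testSystem d (Function.update c i (fatTests 2)) L) ≤ d - 1 := by
  have step : ∀ n, n + 1 ≤ d →
      Module.finrank ℂ (testSystem d (Function.update c i (fatTests 2)) L) ≤
        Module.finrank ℂ (testSystem d (Function.update c i (fatTests (n + 2))) L) + n := by
    intro n
    induction n with
    | zero => simp
    | succ n ih =>
      intro hn
      have h := finrank_le_add_card_of_forall
        (A := testSystem d (Function.update c i (fatTests (n + 3))) L)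
        (B := testSystem d (Function.update c i (fatTests (n + 2))) L)
        (fun _ : Unit => mixedDeriv (L i) (n + 1)) fun f hf h0 =>
          mem_fat_succ_of_mixedDeriv hc hL hmin h2 n (by omega) f hf (h0 ())
      rw [Fintype.card_unit] at h
      have := ih (by omega)
      have e : n + 1 + 2 = n + 3 := rfl
      rw [e]
      omega
  have hbot : ∀ n, d + 1 ≤ n →
      Module.finrank ℂ (testSystem d (Function.update c i (fatTests n)) L) = 0 := by
    intro n hn
    have : testSystem d (Function.update c i (fatTests n)) L = ⊥ := by
      rw [eq_bot_iff]
      intro f hf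
      have hf' := mem_testSystem_update_fat.mp hf
      exact (Submodule.mem_bot ℂ).mpr
        (eq_zero_of_vanishesToOrder hf'.1 (hf'.2.2.mono hn))
    rw [this, finrank_bot]
  rcases Nat.eq_zero_or_pos d with hd | hd
  · rw [hbot 2 (by omega)]
    omega
  · have h := step (d - 1) (by omega)
    rw [hbot (d - 1 + 2) (by omega)] at h
    omega

/-- Triple points at the points with index in `A`, double points at the others. -/
def fatOn (A : Finset (Fin s)) : Fin s → Set LocalTest :=
  fun i => if i ∈ A then fatTests 3 else fatTests 2

lemma finite_fatOn (A : Finset (Fin s)) (i : Fin s) : (fatOn A i).Finite := by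
  unfold fatOn
  split_ifs
  exacts [finite_fatTests 3, finite_fatTests 2]

lemma mem_fatOn {A : Finset (Fin s)} {f : PlaneRing} : f ∈ testSystem d (fatOn A) L ↔
    f.IsHomogeneous d ∧ (∀ i ∈ A, VanishesToOrder 3 (supportPt (L i)) f) ∧
      ∀ i ∉ A, VanishesToOrder 2 (supportPt (L i)) f := by
  rw [mem_testSystem]
  refine and_congr_right fun _ => ⟨fun h => ⟨fun i hi => ?_, fun i hi => ?_⟩, fun h i => ?_⟩
  · have := h i
    rwa [fatOn, if_pos hi, forall_fatTests] at this
  · have := h i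
    rwa [fatOn, if_neg hi, forall_fatTests] at this
  · by_cases hi : i ∈ A
    · rw [fatOn, if_pos hi, forall_fatTests]
      exact h.1 i hi
    · rw [fatOn, if_neg hi, forall_fatTests]
      exact h.2 i hi

lemma update_fatOn_two {A : Finset (Fin s)} {i : Fin s} (hi : i ∉ A) :
    Function.update (fatOn A) i (fatTests 2) = fatOn A := by
  rw [Function.update_eq_self_iff, fatOn, if_neg hi]

lemma update_fatOn_three (A : Finset (Fin s)) (i : Fin s) :
    Function.update (fatOn A) i (fatTests 3) = fatOn (insert i A) := by
  funext k
  by_cases hk : k = i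
  · subst hk; simp [fatOn]
  · simp [fatOn, hk]

/-- A linear system of generic 2-squares whose members all have triple points at
all the supports is zero. -/
lemma finrank_eq_zero_of_triple (hs : 0 < s) (hL : ∀ i, supportPt (L i) 2 ≠ 0)
    (hmin : ∀ (A : Finset (Fin s)) (i : Fin s), ∀ n ≤ d,
      IsMinimal d (Function.update (fatOn A) i (fatTests n)) L)
    (h3 : ∀ i, ∀ f ∈ squareTestSystem d L, VanishesToOrder 3 (supportPt (L i)) f) :
    Module.finrank ℂ (squareTestSystem d L) = 0 := by
  by_contra hne
  have hV : ∀ A, squareTestSystem d L ≤ testSystem d (fatOn A) L := fun A f hf =>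
    mem_fatOn.mpr ⟨(mem_testSystem.mp hf).1, fun i _ => h3 i f hf,
      fun i _ => (h3 i f hf).mono (by omega)⟩
  have hfatOn_ne : ∀ A, testSystem d (fatOn A) L ≠ ⊥ := by
    intro A h
    have := hV A
    rw [h, le_bot_iff] at this
    rw [this, finrank_bot] at hne
    exact hne rfl
  have hstrict : ∀ (A : Finset (Fin s)) (i : Fin s), i ∉ A →
      Module.finrank ℂ (testSystem d (fatOn (insert i A)) L) + 1 ≤
        Module.finrank ℂ (testSystem d (fatOn A) L) := by
    intro A i hi
    refine Submodule.finrank_lt_finrank_of_lt (lt_of_le_of_ne (fun f hf => ?_) fun h => ?_)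
    · rw [← update_fatOn_three, mem_testSystem_update_fat] at hf
      rw [← update_fatOn_two hi, mem_testSystem_update_fat]
      exact ⟨hf.1, hf.2.1, hf.2.2.mono (by omega)⟩
    -- Equality would mean that a triple point comes for free from a double one, forcing the system
    -- to be zero; but it contains the nonzero system of the squares.
    · have hb := testSystem_fat_eq_bot (c := fatOn A) (finite_fatOn A) (hL i) two_pos (hmin A i) (by
        rw [update_fatOn_two hi, update_fatOn_three, h])
      rw [update_fatOn_two hi] at hb
      exact hfatOn_ne A hb
  have hchain : ∀ A B : Finset (Fin s), Disjoint A B →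
      Module.finrank ℂ (testSystem d (fatOn (A ∪ B)) L) + B.card ≤
        Module.finrank ℂ (testSystem d (fatOn A) L) := by
    intro A B
    induction B using Finset.induction_on with
    | empty => intro _; rw [Finset.union_empty, Finset.card_empty, add_zero]
    | insert i B hi ih =>
      intro hd
      rw [Finset.disjoint_insert_right] at hd
      have h1 := ih hd.2
      have h2 := hstrict (A ∪ B) i (by simp [hd.1, hi])
      rw [Finset.union_insert, Finset.card_insert_of_notMem hi]
      omega
  have huniv : Module.finrank ℂ (squareTestSystem d L) ≤
      Module.finrank ℂ (testSystem d (fatOn Finset.univ) L) :=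
    Submodule.finrank_mono (hV _)
  have hτ := hchain ∅ Finset.univ (Finset.disjoint_empty_left _)
  rw [Finset.empty_union, Finset.card_fin] at hτ
  set i : Fin s := ⟨0, hs⟩
  have hi := hchain {i} (Finset.univ.erase i) (by simp)
  rw [Finset.card_erase_of_mem (Finset.mem_univ i), Finset.card_fin,
    show ({i} : Finset (Fin s)) ∪ Finset.univ.erase i = Finset.univ by ext k; simp] at hi
  -- With a square at i and double points elsewhere, s - 1 mixed derivatives cut out the system of
  -- all the squares. The strict chain from {i} to all indices has the same length s - 1, so
  -- imposing a square at i already imposes a triple point there.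
  have hQ : testSystem d (fatOn {i}) L =
      testSystem d (Function.update (fatOn ∅) i squareTests) L := by
    have hle : testSystem d (fatOn {i}) L ≤
        testSystem d (Function.update (fatOn ∅) i squareTests) L := by
      intro f hf
      rw [← LawfulSingleton.insert_empty_eq, ← update_fatOn_three, mem_testSystem_update_fat] at hf
      exact mem_testSystem_update.mpr ⟨hf.1, hf.2.1,
        forall_squareTests.mpr ⟨testAt_inr_eq_zero hf.2.2 _ _, hf.2.2.mono (by omega)⟩⟩
    refine Submodule.eq_of_le_of_finrank_le hle ?_
    have h := finrank_le_add_card_of_forall (A := squareTestSystem d L)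
      (B := testSystem d (Function.update (fatOn ∅) i squareTests) L)
      (fun k : {k : Fin s // k ≠ i} => testAt (L k) (.inr (0, 1))) fun f hf h0 => by
        have hf' := mem_testSystem_update.mp hf
        refine mem_testSystem.mpr ⟨hf'.1, fun k => ?_⟩
        by_cases hk : k = i
        · subst hk; exact hf'.2.2
        · have h2 := hf'.2.1 k hk
          rw [fatOn, if_neg (Finset.notMem_empty k), forall_fatTests] at h2
          exact forall_squareTests.mpr ⟨h0 ⟨k, hk⟩, h2⟩
    have hcard : Fintype.card {k : Fin s // k ≠ i} = s - 1 := by simp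
    omega
  have hτ2 := finrank_fat_two_le (finite_fatOn ∅) (hL i) (hmin ∅ i) fun f hf hm => by
    rw [update_fatOn_three, LawfulSingleton.insert_empty_eq, hQ]
    have hf' := mem_testSystem_update_fat.mp hf
    refine mem_testSystem_update.mpr ⟨hf'.1, hf'.2.1, forall_squareTests.mpr ⟨?_, hf'.2.2⟩⟩
    rw [← hm, mixedDeriv, pow_one]
    rfl
  rw [update_fatOn_two (Finset.notMem_empty i)] at hτ2
  have hN : Module.finrank ℂ (homogeneousSubmodule (Fin 3) ℂ d) ≤
      Module.finrank ℂ (testSystem d (fatOn ∅) L) + Fintype.card (Fin s × Fin 3) :=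
    finrank_le_add_card_of_forall (A := testSystem d (fatOn ∅) L)
    (B := homogeneousSubmodule (Fin 3) ℂ d)
    (fun x : Fin s × Fin 3 => (aeval (supportPt (L x.1))).toLinearMap ∘ₗ
      (pderiv x.2 : Derivation ℂ PlaneRing PlaneRing).toLinearMap) fun f hf h0 => by
      rw [mem_homogeneousSubmodule] at hf
      have h0' : ∀ i k, eval (supportPt (L i)) (pderiv k f) = 0 := fun i k => h0 (i, k)
      refine mem_fatOn.mpr ⟨hf, by simp, fun i _ => VanishesToOrder.succ_iff.mpr
        ⟨?_, fun k => VanishesToOrder.one_iff.mpr (h0' i k)⟩⟩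
      have he := eval_dirDeriv_self hf (supportPt (L i))
      rw [eval_dirDeriv] at he
      simp only [h0', mul_zero, Finset.sum_const_zero] at he
      -- Euler's identity gives the value of f only for d ≠ 0. This follows from the chain: the
      -- double point system has dimension at least s + 1 and at most d - 1.
      exact (mul_eq_zero.mp he.symm).resolve_left (by
        have : d ≠ 0 := by omega
        exact_mod_cast this)
  rw [Fintype.card_prod, Fintype.card_fin, Fintype.card_fin] at hN
  have hN2 := le_finrank_homogeneousSubmodule d
  -- With τ ≤ d - 1 for the double point system and s ≤ d - 2, the space of all forms has dimension
  -- at most τ + 3s ≤ 4d - 7. This contradicts (d + 1)(d + 2)/2, since d² - 5d + 16 is always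
  -- positive.
  have h1 : s + 1 ≤ d - 1 := by omega
  have h2 : 2 * Module.finrank ℂ (homogeneousSubmodule (Fin 3) ℂ d) + 14 ≤ 8 * d := by omega
  have h3 : (d + 1) * (d + 2) + 14 ≤ 8 * d := by omega
  nlinarith [sq_nonneg ((d : ℤ) - 2), sq_nonneg ((d : ℤ) - 3)]

end

/-! ### The ideal of a 2-square and the local shape of its members. -/

noncomputable section

lemma eval_linForm (c p : Fin 3 → ℂ) : eval p (linForm c) = ∑ k, c k * p k := by
  simp [linForm]

lemma isHomogeneous_linForm (c : Fin 3 → ℂ) : (linForm c).IsHomogeneous 1 :=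
  IsHomogeneous.sum _ _ _ fun _ _ => isHomogeneous_C_mul_X _ _

lemma dirDeriv_linForm (w c : Fin 3 → ℂ) : dirDeriv w (linForm c) = C (eval w (linForm c)) := by
  have hX : ∀ k, dirDeriv w (X k : PlaneRing) = C (w k) := by
    intro k
    rw [dirDeriv_apply, Finset.sum_eq_single k]
    · simp [smul_eq_C_mul]
    · intro j _ hj
      rw [pderiv_X_of_ne hj.symm, smul_zero]
    · simp
  rw [eval_linForm, linForm, map_sum, map_sum]
  refine Finset.sum_congr rfl fun k _ => ?_
  rw [Derivation.leibniz, hX, ← algebraMap_eq, Derivation.map_algebraMap, smul_zero, add_zero,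
    smul_eq_mul, map_mul]

lemma IsHomogeneous.eval_smul {n : ℕ} {f : PlaneRing} (hf : f.IsHomogeneous n) (t : ℂ)
    (p : Fin 3 → ℂ) : eval (t • p) f = t ^ n * eval p f := by
  rw [eval_eq', eval_eq', Finset.mul_sum]
  refine Finset.sum_congr rfl fun m hm => ?_
  have hdeg : ∑ i, m i = n := by
    rw [← Finsupp.degree_eq_sum]
    by_contra h
    exact (mem_support_iff.mp hm) (hf.coeff_eq_zero h)
  simp only [Pi.smul_apply, smul_eq_mul, mul_pow, Finset.prod_mul_distrib]
  rw [Finset.prod_pow_eq_pow_sum, hdeg]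
  ring

section Square

variable {L : Fin 2 → Fin 3 → ℂ}

lemma eval_supportPt (L : Fin 2 → Fin 3 → ℂ) (j : Fin 2) :
    eval (supportPt L) (linForm (L j)) = 0 := by
  fin_cases j <;> simp [eval_linForm, Fin.sum_univ_three, supportPt] <;> ring

lemma eval_lineDir_self (L : Fin 2 → Fin 3 → ℂ) (j : Fin 2) :
    eval (lineDir L j) (linForm (L j)) = 0 := by
  simp [eval_linForm, Fin.sum_univ_three, lineDir]
  ring

lemma eval_lineDir_zero_one (L : Fin 2 → Fin 3 → ℂ) :
    eval (lineDir L 0) (linForm (L 1)) = -supportPt L 2 := by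
  simp [eval_linForm, Fin.sum_univ_three, lineDir, supportPt]
  ring

lemma eval_lineDir_one_zero (L : Fin 2 → Fin 3 → ℂ) :
    eval (lineDir L 1) (linForm (L 0)) = supportPt L 2 := by
  simp [eval_linForm, Fin.sum_univ_three, lineDir, supportPt]
  ring

lemma isSupportPoint_supportPt (hL : supportPt L 2 ≠ 0) : IsSupportPoint L (supportPt L) :=
  ⟨fun h => hL (congrFun h 2), eval_supportPt L⟩

lemma linearIndependent_of_supportPt (hL : supportPt L 2 ≠ 0) : LinearIndependent ℂ L := by
  rw [Fintype.linearIndependent_iff]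
  intro g hg
  rw [Fin.sum_univ_two] at hg
  have h : ∀ w, g 0 * eval w (linForm (L 0)) + g 1 * eval w (linForm (L 1)) = 0 := by
    intro w
    have h0 := congrFun hg 0
    have h1 := congrFun hg 1
    have h2 := congrFun hg 2
    simp only [Pi.add_apply, Pi.smul_apply, smul_eq_mul, Pi.zero_apply] at h0 h1 h2
    simp only [eval_linForm, Fin.sum_univ_three]
    linear_combination w 0 * h0 + w 1 * h1 + w 2 * h2
  have h0 := h (lineDir L 1)
  have h1 := h (lineDir L 0)
  rw [eval_lineDir_one_zero, eval_lineDir_self, mul_zero, add_zero] at h0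
  rw [eval_lineDir_zero_one, eval_lineDir_self, mul_zero, zero_add, mul_neg, neg_eq_zero] at h1
  intro i
  fin_cases i
  exacts [(mul_eq_zero.mp h0).resolve_right hL, (mul_eq_zero.mp h1).resolve_right hL]

lemma IsSupportPoint.exists_smul (hL : supportPt L 2 ≠ 0) {p : Fin 3 → ℂ}
    (hp : IsSupportPoint L p) : ∃ t : ℂ, t ≠ 0 ∧ p = t • supportPt L := by
  have h0 := hp.2 0
  have h1 := hp.2 1
  rw [eval_linForm, Fin.sum_univ_three] at h0 h1
  have key : ∀ k, supportPt L 2 * p k = supportPt L k * p 2 := by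
    intro k
    fin_cases k
    · simp [supportPt]
      linear_combination L 1 1 * h0 - L 0 1 * h1
    · simp [supportPt]
      linear_combination L 0 0 * h1 - L 1 0 * h0
    · simp [mul_comm]
  have hpt : p = (p 2 / supportPt L 2) • supportPt L := by
    funext k
    rw [Pi.smul_apply, smul_eq_mul, div_mul_eq_mul_div, eq_div_iff hL]
    linear_combination key k
  refine ⟨_, fun h => hp.1 ?_, hpt⟩
  rw [hpt, h, zero_smul]

/-- At a zero of ℓ, the only surviving terms of the product rule are those in which each factor ℓ is
differentiated once. -/
lemma eval_dirDeriv_dirDeriv_mul_sq {ℓ : PlaneRing} {p : Fin 3 → ℂ} (hℓ : eval p ℓ = 0)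
    (v w : Fin 3 → ℂ) (A : PlaneRing) : eval p (dirDeriv v (dirDeriv w (A * ℓ ^ 2))) =
      2 * eval p A * (eval p (dirDeriv v ℓ) * eval p (dirDeriv w ℓ)) := by
  simp only [pow_two, Derivation.leibniz, smul_eq_mul, map_add, map_mul, hℓ]
  ring

lemma vanishesToOrder_two_mul_sq {ℓ : PlaneRing} {p : Fin 3 → ℂ} (hℓ : eval p ℓ = 0)
    (A : PlaneRing) : VanishesToOrder 2 p (A * ℓ ^ 2) := by
  refine VanishesToOrder.succ_iff.mpr ⟨by simp [hℓ], fun i => VanishesToOrder.one_iff.mpr ?_⟩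
  simp only [pow_two, Derivation.leibniz, smul_eq_mul, map_add, map_mul, hℓ]
  ring

lemma mem_squareIdeal {f : PlaneRing} : f ∈ squareIdeal L ↔
    ∃ A B, A * linForm (L 0) ^ 2 + B * linForm (L 1) ^ 2 = f := Ideal.mem_span_pair

lemma eval_second_deriv {p : Fin 3 → ℂ} (hp : ∀ j, eval p (linForm (L j)) = 0) (A B : PlaneRing)
    (j k : Fin 2) :
    eval p (dirDeriv (lineDir L j) (dirDeriv (lineDir L k)
      (A * linForm (L 0) ^ 2 + B * linForm (L 1) ^ 2))) =
    2 * eval p A * (eval (lineDir L j) (linForm (L 0)) * eval (lineDir L k) (linForm (L 0))) +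
    2 * eval p B * (eval (lineDir L j) (linForm (L 1)) * eval (lineDir L k) (linForm (L 1))) := by
  simp only [map_add]
  rw [eval_dirDeriv_dirDeriv_mul_sq (hp 0), eval_dirDeriv_dirDeriv_mul_sq (hp 1)]
  simp only [dirDeriv_linForm, eval_C]

lemma forall_squareTests_of_mem_squareIdeal {f : PlaneRing} (hf : f ∈ squareIdeal L) :
    ∀ x ∈ squareTests, testAt L x f = 0 := by
  obtain ⟨A, B, rfl⟩ := mem_squareIdeal.mp hf
  refine forall_squareTests.mpr ⟨?_, ?_⟩
  · rw [testAt_inr, eval_second_deriv (eval_supportPt L), eval_lineDir_self, eval_lineDir_self]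
    ring
  · exact (vanishesToOrder_two_mul_sq (eval_supportPt L 0) A).add
      (vanishesToOrder_two_mul_sq (eval_supportPt L 1) B)

/-- The coordinate change that expresses `x, y, z` through the two lines and `z`. -/
def lineCoords (L : Fin 2 → Fin 3 → ℂ) : Fin 3 → PlaneRing :=
  ![C (supportPt L 2)⁻¹ * (C (L 1 1) * (X 0 - C (L 0 2) * X 2) -
      C (L 0 1) * (X 1 - C (L 1 2) * X 2)),
    C (supportPt L 2)⁻¹ * (C (L 0 0) * (X 1 - C (L 1 2) * X 2) -
      C (L 1 0) * (X 0 - C (L 0 2) * X 2)), X 2]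

lemma isHomogeneous_lineCoords (L : Fin 2 → Fin 3 → ℂ) (k : Fin 3) :
    (lineCoords L k).IsHomogeneous 1 := by
  have h : ∀ (i : Fin 3) (c : ℂ), (X i - C c * X 2 : PlaneRing).IsHomogeneous 1 := fun i c =>
    (isHomogeneous_X _ i).sub (isHomogeneous_C_mul_X c 2)
  fin_cases k
  · exact (((h _ _).C_mul _).sub ((h _ _).C_mul _)).C_mul _
  · exact (((h _ _).C_mul _).sub ((h _ _).C_mul _)).C_mul _
  · exact isHomogeneous_X _ _

lemma aeval_aeval_lineCoords (hL : supportPt L 2 ≠ 0) (f : PlaneRing) :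
    aeval ![linForm (L 0), linForm (L 1), X 2] (aeval (lineCoords L) f) = f := by
  have h : ((aeval ![linForm (L 0), linForm (L 1), X 2] : PlaneRing →ₐ[ℂ] PlaneRing).comp
      (aeval (lineCoords L))) = AlgHom.id ℂ PlaneRing := by
    refine MvPolynomial.algHom_ext fun k => ?_
    have hC : (C (supportPt L 2)⁻¹ : PlaneRing) * C (supportPt L 2) = 1 := by
      rw [← C_mul, inv_mul_cancel₀ hL, C_1]
    have hC2 : (C (supportPt L 2) : PlaneRing) =
        C (L 0 0) * C (L 1 1) - C (L 0 1) * C (L 1 0) := by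
      simp [supportPt]
    rw [hC2] at hC
    fin_cases k
    · simp [lineCoords, linForm, Fin.sum_univ_three, -map_inv₀, algHom_C]
      linear_combination X 0 * hC
    · simp [lineCoords, linForm, Fin.sum_univ_three, -map_inv₀, algHom_C]
      linear_combination X 1 * hC
    · simp [lineCoords]
  exact congrArg (fun φ : PlaneRing →ₐ[ℂ] PlaneRing => φ f) h

/-- Modulo the ideal of a 2-square a form is determined by four coefficients. -/
lemma exists_normal_form (hL : supportPt L 2 ≠ 0) {f : PlaneRing} {d : ℕ}
    (hf : f.IsHomogeneous d) : ∃ a b c e : ℂ,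
      f - (C a * X 2 ^ d + C b * (linForm (L 0) * X 2 ^ (d - 1)) +
        C c * (linForm (L 1) * X 2 ^ (d - 1)) +
        C e * (linForm (L 0) * linForm (L 1) * X 2 ^ (d - 2))) ∈ squareIdeal L := by
  set u := linForm (L 0) with hu
  set v := linForm (L 1) with hv
  have hu2 : u ^ 2 ∈ squareIdeal L := Ideal.subset_span (Set.mem_insert _ _)
  have hv2 : v ^ 2 ∈ squareIdeal L := Ideal.subset_span (Set.mem_insert_of_mem _ rfl)
  have key : ∀ F : PlaneRing, F ∈ homogeneousSubmodule (Fin 3) ℂ d → ∃ a b c e : ℂ,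
      aeval ![u, v, X 2] F - (C a * X 2 ^ d + C b * (u * X 2 ^ (d - 1)) +
        C c * (v * X 2 ^ (d - 1)) + C e * (u * v * X 2 ^ (d - 2))) ∈ squareIdeal L := by
    intro F hF
    rw [homogeneousSubmodule_eq_finsupp_supported] at hF
    rw [F.as_sum]
    have hsub : ∀ m ∈ F.support, m.degree = d := fun m hm => hF hm
    clear hF
    generalize F.support = S at hsub ⊢
    induction S using Finset.induction_on with
    | empty => exact ⟨0, 0, 0, 0, by simp⟩
    | insert m S hm ih =>
      obtain ⟨a, b, c, e, h⟩ := ih fun m hm => hsub m (Finset.mem_insert_of_mem hm)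
      have hdeg := hsub m (Finset.mem_insert_self _ _)
      rw [Finsupp.degree_eq_sum, Fin.sum_univ_three] at hdeg
      suffices h' : ∃ a b c e : ℂ,
          aeval ![u, v, X 2] (monomial m (coeff m F)) - (C a * X 2 ^ d + C b * (u * X 2 ^ (d - 1)) +
          C c * (v * X 2 ^ (d - 1)) + C e * (u * v * X 2 ^ (d - 2))) ∈ squareIdeal L by
        obtain ⟨a', b', c', e', h'⟩ := h'
        refine ⟨a' + a, b' + b, c' + c, e' + e, ?_⟩
        rw [Finset.sum_insert hm, map_add]
        convert! Ideal.add_mem _ h' h using 1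
        simp only [map_add]
        ring
      have hmon : aeval ![u, v, X 2] (monomial m (coeff m F)) =
          C (coeff m F) * (u ^ m 0 * v ^ m 1 * X 2 ^ m 2) := by
        rw [aeval_monomial, Finsupp.prod_fintype _ _ (by simp), Fin.prod_univ_three]
        simp [algebraMap_eq]
      rw [hmon]
      by_cases h0 : 2 ≤ m 0
      · refine ⟨0, 0, 0, 0, ?_⟩
        have : C (coeff m F) * (u ^ m 0 * v ^ m 1 * X 2 ^ m 2) =
            C (coeff m F) * (u ^ (m 0 - 2) * v ^ m 1 * X 2 ^ m 2) * u ^ 2 := by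
          conv_lhs => rw [← Nat.sub_add_cancel h0, pow_add]
          ring
        rw [this]
        simpa using Ideal.mul_mem_left _ _ hu2
      by_cases h1 : 2 ≤ m 1
      · refine ⟨0, 0, 0, 0, ?_⟩
        have : C (coeff m F) * (u ^ m 0 * v ^ m 1 * X 2 ^ m 2) =
            C (coeff m F) * (u ^ m 0 * v ^ (m 1 - 2) * X 2 ^ m 2) * v ^ 2 := by
          conv_lhs => rw [← Nat.sub_add_cancel h1, pow_add]
          ring
        rw [this]
        simpa using Ideal.mul_mem_left _ _ hv2
      have hz : ∀ {x : PlaneRing}, x = 0 → x ∈ squareIdeal L := fun h => h ▸ Ideal.zero_mem _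
      rcases (by omega : m 0 = 0 ∨ m 0 = 1) with e0 | e0 <;>
        rcases (by omega : m 1 = 0 ∨ m 1 = 1) with e1 | e1
      · exact ⟨coeff m F, 0, 0, 0, hz (by
          rw [e0, e1, show m 2 = d by omega]; simp)⟩
      · exact ⟨0, 0, coeff m F, 0, hz (by
          rw [e0, e1, show m 2 = d - 1 by omega]; simp)⟩
      · exact ⟨0, coeff m F, 0, 0, hz (by
          rw [e0, e1, show m 2 = d - 1 by omega]; simp)⟩
      · exact ⟨0, 0, 0, coeff m F, hz (by
          rw [e0, e1, show m 2 = d - 2 by omega]; simp)⟩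
  have h := key (aeval (lineCoords L) f) (by
    rw [mem_homogeneousSubmodule]
    simpa using hf.aeval _ (isHomogeneous_lineCoords L))
  rwa [aeval_aeval_lineCoords hL] at h

/-- The quotient by the ideal is spanned in each degree by z^d, L₁ z^(d-1), L₂ z^(d-1), L₁ L₂
z^(d-2), and the tests read off these four coefficients: z is constant along both line directions
and nonzero at the support. For the same reason the truncated exponents in degrees below 2 do no
harm. -/
lemma mem_squareIdeal_of_forall_squareTests (hL : supportPt L 2 ≠ 0) {f : PlaneRing} {d : ℕ}
    (hf : f.IsHomogeneous d) (h : ∀ x ∈ squareTests, testAt L x f = 0) : f ∈ squareIdeal L := by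
  obtain ⟨a, b, c, e, hr⟩ := exists_normal_form hL hf
  set r : PlaneRing := C a * X 2 ^ d + C b * (linForm (L 0) * X 2 ^ (d - 1)) +
        C c * (linForm (L 1) * X 2 ^ (d - 1)) +
        C e * (linForm (L 0) * linForm (L 1) * X 2 ^ (d - 2)) with hr_def
  have ht : ∀ x ∈ squareTests, testAt L x r = 0 := by
    intro x hx
    have h1 := forall_squareTests_of_mem_squareIdeal hr x hx
    rw [map_sub, h x hx, zero_sub, neg_eq_zero] at h1
    exact h1
  obtain ⟨h01, h2⟩ := forall_squareTests.mp ht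
  have hz : ∀ j, dirDeriv (lineDir L j) (X 2 : PlaneRing) = 0 := by
    intro j
    have hX2 : (X 2 : PlaneRing) = linForm ![0, 0, 1] := by simp [linForm, Fin.sum_univ_three]
    rw [hX2, dirDeriv_linForm, eval_linForm]
    simp [Fin.sum_univ_three, lineDir]
  have hzp : ∀ j n, dirDeriv (lineDir L j) ((X 2 : PlaneRing) ^ n) = 0 := by
    intro j n
    rw [Derivation.leibniz_pow, hz, smul_zero, smul_zero]
  have hCd : ∀ j (x : ℂ), dirDeriv (lineDir L j) (C x : PlaneRing) = 0 := fun j x =>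
    Derivation.map_algebraMap _ x
  have hlin : ∀ j k, dirDeriv (lineDir L j) (linForm (L k)) =
      C (eval (lineDir L j) (linForm (L k))) := fun j k => dirDeriv_linForm _ _
  have hpne : ∀ n, (supportPt L 2) ^ n ≠ 0 := fun n => pow_ne_zero n hL
  have ha : a = 0 := by
    have h0 := h2.eval_eq_zero two_pos
    simp only [hr_def, map_add, map_mul, map_pow, eval_supportPt, eval_C, eval_X] at h0
    simpa [hL] using h0
  subst ha
  have hb : b = 0 := by
    have h0 := (h2.dirDeriv (lineDir L 1)).eval_eq_zero one_pos
    simp only [hr_def, Derivation.leibniz, hzp, hCd, hlin, smul_eq_mul, map_add, map_mul, map_pow,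
      eval_supportPt, eval_lineDir_self, eval_lineDir_one_zero, eval_C, eval_X, map_zero] at h0
    simpa [hL] using h0
  subst hb
  have hc : c = 0 := by
    have h0 := (h2.dirDeriv (lineDir L 0)).eval_eq_zero one_pos
    simp only [hr_def, Derivation.leibniz, hzp, hCd, hlin, smul_eq_mul, map_add, map_mul, map_pow,
      eval_supportPt, eval_lineDir_self, eval_lineDir_zero_one, eval_C, eval_X, map_zero] at h0
    simpa [hL] using h0
  subst hc
  have he : e = 0 := by
    rw [testAt_inr] at h01
    simp only [hr_def, Derivation.leibniz, hzp, hCd, hlin, smul_eq_mul, map_add, map_mul, map_pow,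
      eval_supportPt, eval_lineDir_self, eval_lineDir_zero_one, eval_lineDir_one_zero, eval_C,
      eval_X, map_zero] at h01
    simpa [hL] using h01
  subst he
  simpa [hr_def] using hr

/-- Only the constant term of G can contribute in degrees up to that of q. -/
lemma homogeneousComponent_mul_of_le {q : PlaneRing} {k n : ℕ} (hq : q.IsHomogeneous n)
    (hk : k ≤ n) (G : PlaneRing) : homogeneousComponent k (G * q) =
      if k = n then C (coeff 0 G) * q else 0 := by
  induction G using MvPolynomial.induction_on' with
  | monomial m c =>
    have h := (isHomogeneous_monomial (σ := Fin 3) c (n := m.degree) (d := m) rfl).mul hq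
    rw [homogeneousComponent_of_mem ((mem_homogeneousSubmodule _ _).mpr h)]
    by_cases hm : m = 0
    · subst hm
      simp [monomial_zero']
    · have hdeg : m.degree ≠ 0 := by rwa [Ne, Finsupp.degree_eq_zero_iff]
      rw [if_neg (by omega), coeff_monomial, if_neg hm]
      simp
  | add p q hp hq =>
    rw [add_mul, map_add, hp, hq]
    split_ifs
    · rw [coeff_add, C_add, add_mul]
    · rw [add_zero]

lemma taylorAt_linForm {p : Fin 3 → ℂ} {c : Fin 3 → ℂ} (h : eval p (linForm c) = 0) :
    taylorAt p (linForm c) = linForm c := by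
  rw [eval_linForm] at h
  have h' := congrArg (C : ℂ → PlaneRing) h
  rw [map_sum] at h'
  simp only [map_mul, map_zero] at h'
  simp only [taylorAt, linForm, map_sum, map_mul, aeval_X, algHom_C, algebraMap_eq, mul_add,
    Finset.sum_add_distrib]
  rw [h', add_zero]

lemma coeff_zero_taylorAt (p : Fin 3 → ℂ) (f : PlaneRing) : coeff 0 (taylorAt p f) = eval p f := by
  rw [← constantCoeff_eq, taylorAt]
  induction f using MvPolynomial.induction_on with
  | C a => simp
  | add f g hf hg => rw [map_add, map_add, map_add, hf, hg]
  | mul_X f i hf => rw [map_mul, map_mul, map_mul, hf]; simp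

/-- The low-order terms of the Taylor expansion of an element of the ideal of a 2-square. -/
lemma homogeneousComponent_taylorAt {p : Fin 3 → ℂ} (hp : ∀ j, eval p (linForm (L j)) = 0)
    (A B : PlaneRing) {k : ℕ} (hk : k ≤ 2) :
    homogeneousComponent k (taylorAt p (A * linForm (L 0) ^ 2 + B * linForm (L 1) ^ 2)) =
      if k = 2 then C (eval p A) * linForm (L 0) ^ 2 + C (eval p B) * linForm (L 1) ^ 2
      else 0 := by
  have ht : taylorAt p (A * linForm (L 0) ^ 2 + B * linForm (L 1) ^ 2) =
      taylorAt p A * linForm (L 0) ^ 2 + taylorAt p B * linForm (L 1) ^ 2 := by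
    have e0 := taylorAt_linForm (hp 0)
    have e1 := taylorAt_linForm (hp 1)
    unfold taylorAt at e0 e1 ⊢
    rw [map_add, map_mul, map_mul, map_pow, map_pow, e0, e1]
  have hq : ∀ j, (linForm (L j) ^ 2).IsHomogeneous 2 := fun j => (isHomogeneous_linForm _).pow 2
  rw [ht, map_add, homogeneousComponent_mul_of_le (hq 0) hk,
    homogeneousComponent_mul_of_le (hq 1) hk, coeff_zero_taylorAt, coeff_zero_taylorAt]
  split_ifs <;> simp

lemma multiplicityAt_and_tangentCone (hL : supportPt L 2 ≠ 0) {p : Fin 3 → ℂ}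
    (hp : ∀ j, eval p (linForm (L j)) = 0) {A B : PlaneRing}
    (h : eval p A ≠ 0 ∨ eval p B ≠ 0) :
    multiplicityAt (A * linForm (L 0) ^ 2 + B * linForm (L 1) ^ 2) p = 2 ∧
    tangentCone (A * linForm (L 0) ^ 2 + B * linForm (L 1) ^ 2) p =
      C (eval p A) * linForm (L 0) ^ 2 + C (eval p B) * linForm (L 1) ^ 2 := by
  have hne : C (eval p A) * linForm (L 0) ^ 2 + C (eval p B) * linForm (L 1) ^ 2 ≠ 0 := by
    intro h0
    have e0 := congrArg (eval (lineDir L 1)) h0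
    have e1 := congrArg (eval (lineDir L 0)) h0
    simp only [map_add, map_mul, map_pow, eval_C, eval_lineDir_self, eval_lineDir_one_zero,
      eval_lineDir_zero_one, map_zero] at e0 e1
    rcases h with h | h
    · simp [h, hL] at e0
    · simp [h, hL] at e1
  have hm : multiplicityAt (A * linForm (L 0) ^ 2 + B * linForm (L 1) ^ 2) p = 2 := by
    have h2 := homogeneousComponent_taylorAt hp A B le_rfl
    rw [if_pos rfl] at h2
    refine le_antisymm (Nat.sInf_le ?_) (le_csInf ⟨2, ?_⟩ fun k hk => ?_)
    · change homogeneousComponent 2 _ ≠ 0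
      rwa [h2]
    · change homogeneousComponent 2 _ ≠ 0
      rwa [h2]
    · by_contra hlt
      exact hk ((homogeneousComponent_taylorAt hp A B (by omega)).trans (if_neg (by omega)))
  refine ⟨hm, ?_⟩
  rw [tangentCone, hm, homogeneousComponent_taylorAt hp A B le_rfl, if_pos rfl]

lemma linForm_add (c c' : Fin 3 → ℂ) : linForm (c + c') = linForm c + linForm c' := by
  simp [linForm, add_mul, Finset.sum_add_distrib]

lemma linForm_smul (t : ℂ) (c : Fin 3 → ℂ) : linForm (t • c) = C t * linForm c := by
  simp [linForm, Finset.mul_sum, mul_assoc]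

lemma linForm_sub (c c' : Fin 3 → ℂ) : linForm (c - c') = linForm c - linForm c' := by
  simp [linForm, sub_mul, Finset.sum_sub_distrib]

/-- The local conclusion at the support of a 2-square, in terms of second derivatives. -/
lemma local_type (hL : supportPt L 2 ≠ 0) {f : PlaneRing} {d : ℕ} (hf : f.IsHomogeneous d)
    (hI : f ∈ squareIdeal L) (hne : ∃ j, testAt L (.inr (j, j)) f ≠ 0) {p : Fin 3 → ℂ}
    (hp : IsSupportPoint L p) :
    multiplicityAt f p = 2 ∧ (IsSymmetricNode f p L ∨
      ((∃ j, testAt L (.inr (j, j)) f = 0) ∧ HasDoubleTangentAlong f p L)) := by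
  obtain ⟨t, ht, rfl⟩ := hp.exists_smul hL
  obtain ⟨A, B, rfl⟩ := mem_squareIdeal.mp hI
  set p := t • supportPt L with hpdef
  -- The tests are taken at the normalized point `supportPt L`. Second derivatives of a form are
  -- forms, so passing to another representative p changes them by a power of t ≠ 0.
  have hscale : ∀ j, eval p (dirDeriv (lineDir L j) (dirDeriv (lineDir L j)
      (A * linForm (L 0) ^ 2 + B * linForm (L 1) ^ 2))) = t ^ (d - 1 - 1) *
      testAt L (.inr (j, j)) (A * linForm (L 0) ^ 2 + B * linForm (L 1) ^ 2) := fun j =>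
    IsHomogeneous.eval_smul (isHomogeneous_dirDeriv (isHomogeneous_dirDeriv hf _) _) t _
  have hB : testAt L (.inr (0, 0)) (A * linForm (L 0) ^ 2 + B * linForm (L 1) ^ 2) = 0 ↔
      eval p B = 0 := by
    have h := hscale 0
    rw [eval_second_deriv hp.2, eval_lineDir_self, eval_lineDir_zero_one] at h
    constructor
    · intro h0
      rw [h0] at h
      simpa [hL] using h
    · intro h0
      rw [h0] at h
      simpa [ht] using h
  have hA : testAt L (.inr (1, 1)) (A * linForm (L 0) ^ 2 + B * linForm (L 1) ^ 2) = 0 ↔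
      eval p A = 0 := by
    have h := hscale 1
    rw [eval_second_deriv hp.2, eval_lineDir_self, eval_lineDir_one_zero] at h
    constructor
    · intro h0
      rw [h0] at h
      simpa [hL] using h
    · intro h0
      rw [h0] at h
      simpa [ht] using h
  have hAB : eval p A ≠ 0 ∨ eval p B ≠ 0 := by
    obtain ⟨j, hj⟩ := hne
    fin_cases j
    exacts [.inr fun h => hj (hB.mpr h), .inl fun h => hj (hA.mpr h)]
  obtain ⟨hm, hT⟩ := multiplicityAt_and_tangentCone hL hp.2 hAB
  refine ⟨hm, ?_⟩
  by_cases hA0 : eval p A = 0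
  · refine .inr ⟨⟨1, hA.mpr hA0⟩, 1, eval p B, ?_, ?_⟩
    · exact hAB.resolve_left (not_not.mpr hA0)
    · rw [hT, hA0]; simp
  by_cases hB0 : eval p B = 0
  · refine .inr ⟨⟨0, hB.mpr hB0⟩, 0, eval p A, hA0, ?_⟩
    rw [hT, hB0]; simp
  -- Choosing a² = A(p) and b² = -B(p) makes the tangent cone a difference of two squares.
  obtain ⟨a, ha⟩ := IsAlgClosed.exists_pow_nat_eq (eval p A) two_pos
  obtain ⟨b, hb⟩ := IsAlgClosed.exists_pow_nat_eq (-eval p B) two_pos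
  have ha0 : a ≠ 0 := by
    rintro rfl
    exact hA0 (by rw [← ha]; simp)
  have hb0 : b ≠ 0 := by
    rintro rfl
    exact hB0 (by rw [← neg_eq_zero, ← hb]; simp)
  refine .inl ⟨a, b, hm, ?_, ?_⟩
  · have hli := LinearIndependent.pair_iff.mp
      ((LinearIndependent.pair_iff' (K := ℂ) (x := L 0) (y := L 1) (fun h0 => hL (by
        simp [supportPt, h0]))).mpr fun x hx => hL (by
        rw [supportPt, ← hx]; simp; ring))
    rw [LinearIndependent.pair_iff]
    intro x y hxy
    have h := hli ((x + y) * a) ((x - y) * b) (by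
      rw [← hxy]
      module)
    have h1 := (mul_eq_zero.mp h.1).resolve_right ha0
    have h2 := (mul_eq_zero.mp h.2).resolve_right hb0
    exact ⟨by linear_combination (h1 + h2) / 2, by linear_combination (h1 - h2) / 2⟩
  · rw [hT, linForm_add, linForm_sub, linForm_smul, linForm_smul, ← ha,
      show eval p B = -b ^ 2 by rw [hb, neg_neg]]
    simp only [map_neg, map_pow]
    ring

end Square

end

/-! ### Generic squares, symmetry between the points, and conclusion. -/

noncomputable section

variable {s : ℕ} {d : ℕ} {L : Fin s → Fin 2 → Fin 3 → ℂ}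

lemma squareSystem_eq (hL : ∀ i, supportPt (L i) 2 ≠ 0) :
    squareSystem L d = squareTestSystem d L := by
  ext f
  rw [mem_testSystem, squareSystem, unionIdeal, Submodule.mem_inf, mem_homogeneousSubmodule,
    Submodule.restrictScalars_mem, Submodule.mem_iInf]
  exact and_congr_right fun hf => forall_congr' fun i =>
    ⟨forall_squareTests_of_mem_squareIdeal, mem_squareIdeal_of_forall_squareTests (hL i) hf⟩

/-- In degrees `d ≥ 2s` all second derivatives along the lines of disjoint 2-squares occur. -/
lemma exists_second_deriv_ne_zero (hL : ∀ i, supportPt (L i) 2 ≠ 0)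
    (hdis : DefinesDisjointSquares L) (hd : 2 * s ≤ d) (i : Fin s) (j : Fin 2) :
    ∃ f ∈ squareTestSystem d L, testAt (L i) (.inr (j, j)) f ≠ 0 := by
  have hM : ∀ k, ∃ m, k ≠ i → eval (supportPt (L i)) (linForm (L k m)) ≠ 0 := by
    intro k
    by_cases hk : k = i
    · exact ⟨0, fun h => absurd hk h⟩
    · by_contra! h
      exact hdis.2 i k (Ne.symm hk) (supportPt (L i)) ⟨isSupportPoint_supportPt (hL i),
        (isSupportPoint_supportPt (hL i)).1, fun m => (h m).2⟩
  choose m hm using hM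
  set A : PlaneRing := (∏ k ∈ Finset.univ.erase i, linForm (L k (m k)) ^ 2) *
    X 2 ^ (d - 2 * s) with hA
  have hsq : ∀ k n, linForm (L k n) ^ 2 ∈ squareIdeal (L k) := by
    intro k n
    fin_cases n
    exacts [Ideal.subset_span (Set.mem_insert _ _),
      Ideal.subset_span (Set.mem_insert_of_mem _ rfl)]
  have hAp : eval (supportPt (L i)) A ≠ 0 := by
    simp only [hA, map_mul, map_prod, map_pow, eval_X]
    refine mul_ne_zero (Finset.prod_ne_zero_iff.mpr fun k hk => ?_) (pow_ne_zero _ (hL i))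
    exact pow_ne_zero _ (hm k (Finset.ne_of_mem_erase hk))
  have hs : 0 < s := Fin.pos i
  have hhom : (A * linForm (L i (1 - j)) ^ 2).IsHomogeneous d := by
    have h1 : (∏ k ∈ Finset.univ.erase i, linForm (L k (m k)) ^ 2).IsHomogeneous
        (∑ _k ∈ Finset.univ.erase i, 1 * 2) :=
      IsHomogeneous.prod _ _ _ fun k _ => (isHomogeneous_linForm _).pow 2
    have h2 := (h1.mul (isHomogeneous_X_pow (R := ℂ) (2 : Fin 3) (d - 2 * s))).mul
      ((isHomogeneous_linForm (L i (1 - j))).pow 2)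
    convert h2 using 1
    rw [Finset.sum_const, Finset.card_erase_of_mem (Finset.mem_univ i), Finset.card_fin]
    simp only [smul_eq_mul]
    omega
  refine ⟨A * linForm (L i (1 - j)) ^ 2, ?_, ?_⟩
  · rw [← squareSystem_eq hL, squareSystem, unionIdeal, Submodule.mem_inf,
      mem_homogeneousSubmodule, Submodule.restrictScalars_mem, Submodule.mem_iInf]
    refine ⟨hhom, fun k => ?_⟩
    by_cases hk : k = i
    · subst hk
      exact Ideal.mul_mem_left _ _ (hsq _ _)
    · refine Ideal.mul_mem_right _ _ (Ideal.mul_mem_right _ _ ?_)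
      rw [← Finset.mul_prod_erase _ _ (Finset.mem_erase.mpr ⟨hk, Finset.mem_univ k⟩)]
      exact Ideal.mul_mem_right _ _ (hsq _ _)
  · rw [testAt_inr, eval_dirDeriv_dirDeriv_mul_sq (eval_supportPt _ _), dirDeriv_linForm, eval_C]
    have h : eval (lineDir (L i) j) (linForm (L i (1 - j))) ≠ 0 := by
      fin_cases j
      · simpa [eval_lineDir_zero_one] using hL i
      · simpa [eval_lineDir_one_zero] using hL i
    exact mul_ne_zero (mul_ne_zero two_ne_zero hAp) (mul_ne_zero h h)

/-- The test sets used at each point in degree `d`. -/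
def admissibleTests (d : ℕ) : Set (Set LocalTest) :=
  insert squareTests (Set.range tangentTests ∪ fatTests '' Set.Iic (d + 3))

lemma finite_admissibleTests (d : ℕ) : (admissibleTests d).Finite :=
  ((Set.finite_range _).union ((Set.finite_Iic _).image _)).insert _

lemma finite_of_mem_admissibleTests {T : Set LocalTest} (hT : T ∈ admissibleTests d) :
    T.Finite := by
  rcases hT with rfl | ⟨j, rfl⟩ | ⟨n, -, rfl⟩
  exacts [finite_squareTests, finite_tangentTests j, finite_fatTests n]

lemma fatTests_mem_admissibleTests {n : ℕ} (hn : n ≤ d + 3) : fatTests n ∈ admissibleTests d :=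
  .inr (.inr ⟨n, hn, rfl⟩)

lemma tangentTests_mem_admissibleTests (j : Fin 2) : tangentTests j ∈ admissibleTests d :=
  .inr (.inl ⟨j, rfl⟩)

lemma squareTests_mem_admissibleTests : squareTests ∈ admissibleTests d := .inl rfl

/-- All linear systems in degree `d` that are relevant have minimal dimension at `L`. -/
def IsGenericInDegree (d : ℕ) (L : Fin s → Fin 2 → Fin 3 → ℂ) : Prop :=
  ∀ c : Fin s → Set LocalTest, (∀ i, c i ∈ admissibleTests d) → IsMinimal d c L

/-- Genericity in a fixed degree involves only finitely many assignments of test sets to points, and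
each is minimal on a nonempty open set. -/
lemma holdsGenerically_isGenericInDegree (s d : ℕ) :
    HoldsGenerically (Fin s → Fin 2 → Fin 3 → ℂ) (IsGenericInDegree d) := by
  have hfin : {c : Fin s → Set LocalTest | ∀ i, c i ∈ admissibleTests d}.Finite := by
    have := Set.Finite.pi' (fun _ : Fin s => finite_admissibleTests d)
    exact this
  exact holdsGenerically_forall_mem hfin fun c hc =>
    holdsGenerically_isMinimal fun i => finite_of_mem_admissibleTests (hc i)

lemma IsGenericInDegree.update (h : IsGenericInDegree d L) {c : Fin s → Set LocalTest}
    (hc : ∀ k, c k ∈ admissibleTests d) (i : Fin s) {T : Set LocalTest}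
    (hT : T ∈ admissibleTests d) : IsMinimal d (Function.update c i T) L := by
  refine h _ fun k => ?_
  by_cases hk : k = i
  · subst hk; simpa using hT
  · simpa [hk] using hc k

lemma fatOn_mem_admissibleTests (A : Finset (Fin s)) (i : Fin s) :
    fatOn A i ∈ admissibleTests d := by
  unfold fatOn
  split_ifs
  -- Double and triple points must be admissible in every degree, including d = 0; this is what the
  -- bound `d + 3` on the multiplicity allows for.
  exacts [fatTests_mem_admissibleTests (by omega), fatTests_mem_admissibleTests (by omega)]

lemma testSystem_comp_perm (c : Fin s → Set LocalTest) (σ : Equiv.Perm (Fin s)) :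
    testSystem d (fun i => c (σ i)) (fun i => L (σ i)) = testSystem d c L := by
  ext f
  rw [mem_testSystem, mem_testSystem]
  exact and_congr_right fun _ => σ.forall_congr_left.trans (by simp)

/-- Relabelling the squares carries one system to the other, so both have the same minimal dimension
over all parameters. -/
lemma IsMinimal.finrank_comp_perm {c : Fin s → Set LocalTest} {σ : Equiv.Perm (Fin s)}
    (h : IsMinimal d c L) (h' : IsMinimal d (fun i => c (σ i)) L) :
    Module.finrank ℂ (testSystem d (fun i => c (σ i)) L) =
      Module.finrank ℂ (testSystem d c L) := by
  refine le_antisymm ?_ ?_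
  · have h1 := h' fun i => L (σ i)
    rwa [testSystem_comp_perm] at h1
  · have e : testSystem d (fun i => c (σ i)) L = testSystem d c fun i => L (σ.symm i) := by
      rw [← testSystem_comp_perm c σ]
      simp only [Equiv.symm_apply_apply]
    rw [e]
    exact h _

/-- By symmetry the identical vanishing of a second derivative does not depend on the point. -/
lemma forall_testAt_eq_zero_of_generic (h : IsGenericInDegree d L) {i k : Fin s} {j : Fin 2}
    (hi : ∀ f ∈ squareTestSystem d L, testAt (L i) (.inr (j, j)) f = 0) :
    ∀ f ∈ squareTestSystem d L, testAt (L k) (.inr (j, j)) f = 0 := by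
  rw [forall_testAt_eq_zero_iff_finrank] at hi ⊢
  rw [← hi]
  have hm : ∀ i, IsMinimal d (Function.update (fun _ => squareTests) i (tangentTests j)) L :=
    fun i => h.update (fun _ => squareTests_mem_admissibleTests) i
      (tangentTests_mem_admissibleTests j)
  have e : (fun m => Function.update (fun _ => squareTests) i (tangentTests j)
      (Equiv.swap i k m)) = Function.update (fun _ => squareTests) k (tangentTests j) := by
    funext m
    simp only [Function.update_apply, Equiv.swap_apply_eq_iff, Equiv.swap_apply_left]
  have h1 := (hm i).finrank_comp_perm (σ := Equiv.swap i k) (by rw [e]; exact hm k)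
  rwa [e] at h1

/-- The dichotomy between nodes and double tangents, for the second derivatives. -/
lemma second_deriv_dichotomy (h : IsGenericInDegree d L) (hL : ∀ i, supportPt (L i) 2 ≠ 0)
    (hpos : 0 < Module.finrank ℂ (squareTestSystem d L)) (i : Fin s) :
    (∃ j, ∃ f ∈ squareTestSystem d L, testAt (L i) (.inr (j, j)) f ≠ 0) ∧
      ∀ j, (∀ f ∈ squareTestSystem d L, testAt (L i) (.inr (j, j)) f = 0) →
        Module.finrank ℂ (squareTestSystem d L) = 1 := by
  have hex : ∃ j, ∃ f ∈ squareTestSystem d L, testAt (L i) (.inr (j, j)) f ≠ 0 := by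
    -- If both second derivatives vanish identically at one point, symmetry spreads this to all
    -- points, and every member is triple everywhere.
    by_contra! hcon
    refine hpos.ne' (finrank_eq_zero_of_triple (Fin.pos i) hL (fun A k n hn =>
      h.update (fatOn_mem_admissibleTests A) k (fatTests_mem_admissibleTests (by omega)))
      fun k f hf => ?_)
    have hf' := mem_testSystem.mp hf
    obtain ⟨h01, h2⟩ := forall_squareTests.mp (hf'.2 k)
    exact vanishesToOrder_three (hL k) hf'.1 h2 (forall_testAt_inr h01 fun j =>
      forall_testAt_eq_zero_of_generic h (hcon j) f hf)
  refine ⟨hex, fun j hj => le_antisymm ?_ hpos⟩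
  refine finrank_squareTestSystem_le_one (hL i) (h _ fun _ => squareTests_mem_admissibleTests)
    (fun k => h.update (fun _ => squareTests_mem_admissibleTests) i
      (tangentTests_mem_admissibleTests k))
    (fun n hn => h.update (fun _ => squareTests_mem_admissibleTests) i
      (fatTests_mem_admissibleTests (by omega))) hj ?_
  obtain ⟨k, f, hf, hfk⟩ := hex
  rcases eq_or_eq_one_sub j k with rfl | rfl
  · exact absurd (hj f hf) hfk
  · exact ⟨f, hf, hfk⟩

lemma holdsGenerically_supportPt_ne_zero (i : Fin s) :
    HoldsGenerically (Fin s → Fin 2 → Fin 3 → ℂ) fun L => supportPt (L i) 2 ≠ 0 :=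
  holdsGenerically_of_ne_zero (supportPt_mem_polyFun i 2)
    ⟨fun _ => ![![1, 0, 0], ![0, 1, 0]], by simp [supportPt]⟩

lemma holdsGenerically_disjoint {i k : Fin s} (hik : i ≠ k) :
    HoldsGenerically (Fin s → Fin 2 → Fin 3 → ℂ) fun L =>
      eval (supportPt (L i)) (linForm (L k 0)) ≠ 0 := by
  refine holdsGenerically_of_ne_zero ?_
    ⟨fun m => if m = i then ![![1, 0, 0], ![0, 1, 0]] else ![![0, 0, 1], 0], ?_⟩
  · simp only [eval_linForm]
    exact sum_mem_polyFun _ fun m _ =>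
      mul_mem_polyFun (coord_mem_polyFun k 0 m) (supportPt_mem_polyFun i m)
  · simp [hik.symm, eval_linForm, supportPt, Fin.sum_univ_three]

lemma definesDisjointSquares_of_ne_zero (hL : ∀ i, supportPt (L i) 2 ≠ 0)
    (h : ∀ i k, i ≠ k → eval (supportPt (L i)) (linForm (L k 0)) ≠ 0) :
    DefinesDisjointSquares L := by
  refine ⟨fun i => linearIndependent_of_supportPt (hL i), fun i k hik p ⟨hi, hk⟩ => ?_⟩
  obtain ⟨t, ht, rfl⟩ := hi.exists_smul (hL i)
  have h1 := hk.2 0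
  rw [IsHomogeneous.eval_smul (isHomogeneous_linForm _), pow_one] at h1
  exact h i k hik ((mul_eq_zero.mp h1).resolve_left ht)

/-- A linear functional that is not identically zero on `V` is generically nonzero on `V`. -/
lemma holdsGenerically_functional (V : Submodule ℂ PlaneRing) (φ : PlaneRing →ₗ[ℂ] ℂ) :
    HoldsGenerically V fun f => (∃ g ∈ V, φ g ≠ 0) → φ f ≠ 0 := by
  by_cases h : ∃ g ∈ V, φ g ≠ 0
  · obtain ⟨g, hg, hne⟩ := h
    exact (holdsGenerically_of_ne_zero (dual_mem_polyFun (φ ∘ₗ V.subtype)) ⟨⟨g, hg⟩, hne⟩).mono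
      fun f hf _ => hf
  · exact .of_forall fun f h' => absurd h' h

lemma holdsGenerically_ne_zero (V : Submodule ℂ PlaneRing) (hV : 0 < Module.finrank ℂ V) :
    HoldsGenerically V fun f => (f : PlaneRing) ≠ 0 := by
  have := Module.nontrivial_of_finrank_pos hV
  obtain ⟨v, hv⟩ := exists_ne (0 : V)
  obtain ⟨φ, hφ⟩ := Module.Projective.exists_dual_ne_zero ℂ hv
  refine (holdsGenerically_of_ne_zero (dual_mem_polyFun φ) ⟨v, hφ⟩).mono fun f hf h0 => hf ?_
  rw [show f = 0 from Subtype.ext h0, map_zero]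

end

theorem mainTheorem3 (s : ℕ) :
    HoldsGenerically (Fin s → Fin 2 → Fin 3 → ℂ) fun L =>
      DefinesDisjointSquares L ∧
        ∀ d : ℕ, 0 < Module.finrank ℂ (squareSystem L d) →
          HoldsGenerically (squareSystem L d) fun f =>
            (f : PlaneRing) ≠ 0 ∧
              ∀ (i : Fin s) (p : Fin 3 → ℂ), IsSupportPoint (L i) p →
                multiplicityAt (f : PlaneRing) p = 2 ∧
                  (IsSymmetricNode (f : PlaneRing) p (L i) ∨
                    (Module.finrank ℂ (squareSystem L d) = 1 ∧
                      HasDoubleTangentAlong (f : PlaneRing) p (L i))) := by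
  have hdisj := holdsGenerically_forall fun x : {x : Fin s × Fin s // x.1 ≠ x.2} =>
    holdsGenerically_disjoint x.2
  -- Restricting to d < 2s keeps the number of open conditions finite, so that one open set of
  -- squares serves all degrees.
  have hgen := holdsGenerically_forall_mem (Set.finite_Iio (2 * s)) fun d _ =>
    holdsGenerically_isGenericInDegree s d
  refine (((holdsGenerically_forall holdsGenerically_supportPt_ne_zero).and hdisj).and hgen).mono
    fun L ⟨⟨hL, hdis⟩, hgen⟩ => ?_
  have hD : DefinesDisjointSquares L :=
    definesDisjointSquares_of_ne_zero hL fun i k hik => hdis ⟨(i, k), hik⟩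
  refine ⟨hD, fun d hpos => ?_⟩
  have key : ∀ i, (∃ j, ∃ f ∈ squareSystem L d, testAt (L i) (.inr (j, j)) f ≠ 0) ∧
      ∀ j, (∀ f ∈ squareSystem L d, testAt (L i) (.inr (j, j)) f = 0) →
        Module.finrank ℂ (squareSystem L d) = 1 := by
    rw [squareSystem_eq hL] at hpos ⊢
    intro i
    rcases lt_or_ge d (2 * s) with hd | hd
    · exact second_deriv_dichotomy (hgen d hd) hL hpos i
    · refine ⟨⟨0, exists_second_deriv_ne_zero hL hD hd i 0⟩, fun j hj => ?_⟩
      obtain ⟨f, hf, hne⟩ := exists_second_deriv_ne_zero hL hD hd i j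
      exact absurd (hj f hf) hne
  -- A generic f avoids the kernel of each of the 2s second derivatives that is not identically
  -- zero. So a derivative vanishing at f vanishes on all of V_d.
  have htests := holdsGenerically_forall fun x : Fin s × Fin 2 =>
    holdsGenerically_functional (squareSystem L d) (testAt (L x.1) (.inr (x.2, x.2)))
  refine ((holdsGenerically_ne_zero _ hpos).and htests).mono fun f ⟨hf0, hf⟩ =>
    ⟨hf0, fun i p hp => ?_⟩
  have hfd : (f : PlaneRing).IsHomogeneous d := (mem_homogeneousSubmodule _ _).mp f.2.1
  have hfI : (f : PlaneRing) ∈ squareIdeal (L i) := (Submodule.mem_iInf _).mp f.2.2 i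
  obtain ⟨⟨j, hj⟩, hone⟩ := key i
  obtain ⟨hm, h⟩ := local_type (hL i) hfd hfI ⟨j, hf (i, j) hj⟩ hp
  refine ⟨hm, h.imp_right fun ⟨⟨k, hk⟩, hdouble⟩ => ⟨hone k ?_, hdouble⟩⟩
  by_contra! hcon
  exact hf (i, k) hcon hk
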